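/- Let $\mathfrak g=\mathfrak{spin}(3,1)_{\mathbb C}$ be the complex Lie algebra with basis $J_0,J_1,J_2,K_0,K_1,K_2$ and brackets $[J_a,J_b]=i\varepsilon_{abc}J_c$, $[J_a,K_b]=i\varepsilon_{abc}K_c$, $[K_a,K_b]=-i\varepsilon_{abc}J_c$; put $J_\pm=J_1\pm iJ_2$, $K_\pm=K_1\pm iK_2$, $C_\pm(j,m)=\sqrt{j\mp m}\sqrt{j\pm m+1}$ and $\mathcal M_j=\{-j,-j+1,\dots,j\}$. For $\lambda\in\tfrac12\mathbb Z$, $\rho\in\mathbb C$ let $V_{\lambda,\rho}$ be the irreducible module with orthonormal basis $|(\lambda,\rho)\,j,m\rangle$, $j\in\{|\lambda|,|\lambda|+1,\dots,j_{\max}\}$, $m\in\mathcal M_j$, on which $J_0|j,m\rangle=m|j,m\rangle$, $J_\pm|j,m\rangle=C_\pm(j,m)|j,m\pm1\rangle$ and $$K_0|j,m\rangle=P^+(j)\sqrt{j+m+1}\sqrt{j-m+1}\,|j{+}1,m\rangle+P(j)\,m\,|j,m\rangle+P^-(j)\sqrt{j+m}\sqrt{j-m}\,|j{-}1,m\rangle,$$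 $$K_\pm|j,m\rangle=\mp P^+(j)\sqrt{j\pm m+1}\sqrt{j\pm m+2}\,|j{+}1,m{\pm}1\rangle+P(j)C_\pm(j,m)|j,m{\pm}1\rangle\pm P^-(j)\sqrt{j\mp m}\sqrt{j\mp m-1}\,|j{-}1,m{\pm}1\rangle,$$ where $P^-(j)=\frac{\sqrt{j+\lambda}\sqrt{j-\lambda}\sqrt{j+\rho}\sqrt{j-\rho}}{j\sqrt{2j+1}\sqrt{2j-1}}$ (principal square roots; read as $0$ where the denominator vanishes), $P^+(j)=P^-(j+1)$, $P(j)=\frac{i\lambda\rho}{j(j+1)}$ for $j\ne0$, $P(0)=0$, and $j_{\max}$ is the first $j\in|\lambda|+\mathbb N_0$ with $P^+(j)=0$ ($j_{\max}=\infty$ if there is none). For $\gamma\in\tfrac12\mathbb N_0$, $A=\pm1$, let $F^A_\gamma$ have basis $|\gamma_A,\mu\rangle$, $\mu\in\mathcal M_\gamma$, with $J_0,J_\pm$ acting by $\mu$ and $C_\pm(\gamma,\mu)$ as above and $K_a=iA\,J_a$; let $(\gamma_1,\gamma_2)=F^{-}_{\gamma_1}\otimes F^{+}_{\gamma_2}$,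 with basis $|(\gamma_1,\gamma_2)\,\mu_1,\mu_2\rangle=|(\gamma_1)_-,\mu_1\rangle\otimes|(\gamma_2)_+,\mu_2\rangle$. A tensor operator $T:(\gamma_1,\gamma_2)\otimes V_{\lambda,\rho}\to V_{\lambda',\rho'}$ is a linear map commuting with the action of $\mathfrak g$ (as $\mathrm{SU}(2)$ is connected, it then commutes with $\mathrm{SU}(2)$ as well). A Clebsch–Gordan decomposition of $(\gamma_1,\gamma_2)\otimes V_{\lambda,\rho}$ is a decomposition $\bigoplus_{i}W_i$ into irreducible submodules. Let $\alpha$ range over the indices with $W_\alpha\cong V_{\lambda',\rho'}$, and for each of them fix an isomorphism $\varphi_\alpha:V_{\lambda',\rho'}\to W_\alpha$ and put $|[\alpha](\lambda',\rho')\,j',m'\rangle=\varphi_\alpha|(\lambda',\rho')\,j',m'\rangle$. The inverse Clebsch–Gordan coefficient $\mathrm B\{[\alpha](\lambda',\rho')\,j',m'\,|\,(\gamma_1,\gamma_2)\,\mu_1,\mu_2;(\lambda,\rho)\,j,m\}$ is the coefficient of $|[\alpha](\lambda',\rho')\,j',m'\rangle$ in the expansion of $|(\gamma_1,\gamma_2)\,\mu_1,\mu_2\rangle\otimes|(\lambda,\rho)\,j,m\rangle$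 along the decomposition. **Statement.** Let $T:(\gamma_1,\gamma_2)\otimes V_{\lambda,\rho}\to V_{\lambda',\rho'}$ be a tensor operator with $V_{\lambda,\rho}$ and $V_{\lambda',\rho'}$ infinite-dimensional, and suppose that a Clebsch–Gordan decomposition of $(\gamma_1,\gamma_2)\otimes V_{\lambda,\rho}$ is given. Then only finitely many $\alpha$ occur, and there are constants $N_\alpha\in\mathbb C$, independent of $j',m',\mu_1,\mu_2,j,m$, such that for all basis vectors $$\langle(\lambda',\rho')\,j',m'|T|(\gamma_1,\gamma_2)\,\mu_1,\mu_2;(\lambda,\rho)\,j,m\rangle=\sum_\alpha N_\alpha\,\mathrm B\{[\alpha](\lambda',\rho')\,j',m'\,|\,(\gamma_1,\gamma_2)\,\mu_1,\mu_2;(\lambda,\rho)\,j,m\}.$$ In particular, if no $W_i$ is isomorphic to $V_{\lambda',\rho'}$, then $T=0$. -/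

import Mathlib

open scoped TensorProduct Matrix

noncomputable section

set_option linter.unusedSimpArgs false
set_option linter.unreachableTactic false
set_option linter.unusedTactic false
set_option linter.unusedVariables false

/-! ### The complex Lie algebra `𝔰𝔭𝔦𝔫(3,1)_ℂ` -/

/-- The complexified Lie algebra of `Spin(3,1)`. The pair `(a, b)` stands for
`∑ c, (a c • J_c + b c • K_c)`: the first three coordinates belong to the rotation generators
`J_0, J_1, J_2`, the last three to the boost generators `K_0, K_1, K_2`. -/
def LorentzAlgebra : Type := (Fin 3 → ℂ) × (Fin 3 → ℂ)

namespace LorentzAlgebra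

instance : AddCommGroup LorentzAlgebra :=
  inferInstanceAs (AddCommGroup ((Fin 3 → ℂ) × (Fin 3 → ℂ)))

instance : Module ℂ LorentzAlgebra :=
  inferInstanceAs (Module ℂ ((Fin 3 → ℂ) × (Fin 3 → ℂ)))

/-- The bracket, i.e. the bilinear extension of `[J_a, J_b] = i ε_{abc} J_c`,
`[J_a, K_b] = i ε_{abc} K_c`, `[K_a, K_b] = - i ε_{abc} J_c`. -/
instance : Bracket LorentzAlgebra LorentzAlgebra where
  bracket X Y := (Complex.I • (X.1 ⨯₃ Y.1) - Complex.I • (X.2 ⨯₃ Y.2),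
    Complex.I • (X.1 ⨯₃ Y.2) + Complex.I • (X.2 ⨯₃ Y.1))

theorem bracket_fst (X Y : LorentzAlgebra) :
    ⁅X, Y⁆.1 = Complex.I • (X.1 ⨯₃ Y.1) - Complex.I • (X.2 ⨯₃ Y.2) := rfl
theorem bracket_snd (X Y : LorentzAlgebra) :
    ⁅X, Y⁆.2 = Complex.I • (X.1 ⨯₃ Y.2) + Complex.I • (X.2 ⨯₃ Y.1) := rfl
theorem add_fst (X Y : LorentzAlgebra) : (X + Y).1 = X.1 + Y.1 := rfl
theorem add_snd (X Y : LorentzAlgebra) : (X + Y).2 = X.2 + Y.2 := rfl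
theorem smul_fst (c : ℂ) (X : LorentzAlgebra) : (c • X).1 = c • X.1 := rfl
theorem smul_snd (c : ℂ) (X : LorentzAlgebra) : (c • X).2 = c • X.2 := rfl
theorem zero_fst : (0 : LorentzAlgebra).1 = 0 := rfl
theorem zero_snd : (0 : LorentzAlgebra).2 = 0 := rfl

theorem ext' {X Y : LorentzAlgebra} (h₁ : X.1 = Y.1) (h₂ : X.2 = Y.2) : X = Y := Prod.ext h₁ h₂

instance : LieRing LorentzAlgebra where
  add_lie X Y Z := by
    apply ext' <;> ext i <;> fin_cases i <;>
      simp [bracket_fst, bracket_snd, add_fst, add_snd, cross_apply] <;> ring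
  lie_add X Y Z := by
    apply ext' <;> ext i <;> fin_cases i <;>
      simp [bracket_fst, bracket_snd, add_fst, add_snd, cross_apply] <;> ring
  lie_self X := by
    apply ext' <;> ext i <;> fin_cases i <;>
      simp [bracket_fst, bracket_snd, zero_fst, zero_snd, cross_apply] <;> ring
  leibniz_lie X Y Z := by
    apply ext' <;> ext i <;> fin_cases i <;>
      simp [bracket_fst, bracket_snd, add_fst, add_snd, cross_apply] <;> ring

instance : LieAlgebra ℂ LorentzAlgebra where
  lie_smul c X Y := by
    apply ext' <;> ext i <;> fin_cases i <;>
      simp [bracket_fst, bracket_snd, smul_fst, smul_snd, cross_apply] <;> ring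

/-- Operators representing `J_0`, `J_± = J_1 ± i J_2`, `K_0`, `K_± = K_1 ± i K_2`, subject to the
commutation relations of the Lorentz algebra. -/
structure Generators (E : Type*) [AddCommGroup E] [Module ℂ E] where
  (J0 Jp Jm K0 Kp Km : Module.End ℂ E)
  J0_Jp : J0 * Jp - Jp * J0 = Jp
  J0_Jm : J0 * Jm - Jm * J0 = -Jm
  Jp_Jm : Jp * Jm - Jm * Jp = (2 : ℂ) • J0
  J0_K0 : J0 * K0 - K0 * J0 = 0
  J0_Kp : J0 * Kp - Kp * J0 = Kp
  J0_Km : J0 * Km - Km * J0 = -Km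
  Jp_K0 : Jp * K0 - K0 * Jp = -Kp
  Jp_Kp : Jp * Kp - Kp * Jp = 0
  Jp_Km : Jp * Km - Km * Jp = (2 : ℂ) • K0
  Jm_K0 : Jm * K0 - K0 * Jm = Km
  Jm_Kp : Jm * Kp - Kp * Jm = -((2 : ℂ) • K0)
  Jm_Km : Jm * Km - Km * Jm = 0
  K0_Kp : K0 * Kp - Kp * K0 = -Jp
  K0_Km : K0 * Km - Km * K0 = Jm
  Kp_Km : Kp * Km - Km * Kp = -((2 : ℂ) • J0)

namespace Generators

variable {E : Type*} [AddCommGroup E] [Module ℂ E] (G : Generators E)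

/-- The operator by which `X` acts: `∑ c, (X.1 c • J_c + X.2 c • K_c)`, with
`J_1 = (J_+ + J_-) / 2`, `J_2 = (J_+ - J_-) / (2 i)` and likewise for `K_1`, `K_2`. -/
def op : LorentzAlgebra →ₗ[ℂ] Module.End ℂ E where
  toFun X := X.1 0 • G.J0 + X.1 1 • ((1 / 2 : ℂ) • (G.Jp + G.Jm))
    + X.1 2 • ((1 / (2 * Complex.I) : ℂ) • (G.Jp - G.Jm))
    + X.2 0 • G.K0 + X.2 1 • ((1 / 2 : ℂ) • (G.Kp + G.Km))
    + X.2 2 • ((1 / (2 * Complex.I) : ℂ) • (G.Kp - G.Km))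
  map_add' X Y := by
    simp only [add_fst, add_snd, Pi.add_apply]
    module
  map_smul' c X := by
    simp only [smul_fst, smul_snd, Pi.smul_apply, smul_eq_mul, RingHom.id_apply]
    module

theorem op_eq (X : LorentzAlgebra) : G.op X = X.1 0 • G.J0
    + ((X.1 1 - Complex.I * X.1 2) / 2) • G.Jp + ((X.1 1 + Complex.I * X.1 2) / 2) • G.Jm
    + X.2 0 • G.K0 + ((X.2 1 - Complex.I * X.2 2) / 2) • G.Kp
    + ((X.2 1 + Complex.I * X.2 2) / 2) • G.Km := by
  have h : (1 / (2 * Complex.I) : ℂ) = -Complex.I / 2 := by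
    field_simp; simp
  simp only [op, LinearMap.coe_mk, AddHom.coe_mk, h]
  module

theorem op_lie (X Y : LorentzAlgebra) :
    G.op ⁅X, Y⁆ = G.op X * G.op Y - G.op Y * G.op X := by
  obtain ⟨x0, hx0⟩ : ∃ c, c = X.1 0 := ⟨_, rfl⟩
  obtain ⟨x1, hx1⟩ : ∃ c, c = (X.1 1 - Complex.I * X.1 2) / 2 := ⟨_, rfl⟩
  obtain ⟨x2, hx2⟩ : ∃ c, c = (X.1 1 + Complex.I * X.1 2) / 2 := ⟨_, rfl⟩
  obtain ⟨x3, hx3⟩ : ∃ c, c = X.2 0 := ⟨_, rfl⟩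
  obtain ⟨x4, hx4⟩ : ∃ c, c = (X.2 1 - Complex.I * X.2 2) / 2 := ⟨_, rfl⟩
  obtain ⟨x5, hx5⟩ : ∃ c, c = (X.2 1 + Complex.I * X.2 2) / 2 := ⟨_, rfl⟩
  obtain ⟨y0, hy0⟩ : ∃ c, c = Y.1 0 := ⟨_, rfl⟩
  obtain ⟨y1, hy1⟩ : ∃ c, c = (Y.1 1 - Complex.I * Y.1 2) / 2 := ⟨_, rfl⟩
  obtain ⟨y2, hy2⟩ : ∃ c, c = (Y.1 1 + Complex.I * Y.1 2) / 2 := ⟨_, rfl⟩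
  obtain ⟨y3, hy3⟩ : ∃ c, c = Y.2 0 := ⟨_, rfl⟩
  obtain ⟨y4, hy4⟩ : ∃ c, c = (Y.2 1 - Complex.I * Y.2 2) / 2 := ⟨_, rfl⟩
  obtain ⟨y5, hy5⟩ : ∃ c, c = (Y.2 1 + Complex.I * Y.2 2) / 2 := ⟨_, rfl⟩
  have hz0 : ⁅X, Y⁆.1 0 =
      2 * (x1 * y2 - x2 * y1) - 2 * (x4 * y5 - x5 * y4) := by
    subst_vars
    simp only [bracket_fst, Pi.sub_apply, Pi.smul_apply, smul_eq_mul,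
      cross_apply, Matrix.cons_val]
    ring_nf
  have hz1 : (⁅X, Y⁆.1 1 - Complex.I * ⁅X, Y⁆.1 2) / 2 =
      (x0 * y1 - x1 * y0) - (x3 * y4 - x4 * y3) := by
    subst_vars
    simp only [bracket_fst, Pi.sub_apply, Pi.smul_apply, smul_eq_mul,
      cross_apply, Matrix.cons_val]
    ring_nf
    simp only [Complex.I_sq]
    ring
  have hz2 : (⁅X, Y⁆.1 1 + Complex.I * ⁅X, Y⁆.1 2) / 2 =
      -(x0 * y2 - x2 * y0) + (x3 * y5 - x5 * y3) := by
    subst_vars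
    simp only [bracket_fst, Pi.sub_apply, Pi.smul_apply, smul_eq_mul,
      cross_apply, Matrix.cons_val]
    ring_nf
    simp only [Complex.I_sq]
    ring
  have hz3 : ⁅X, Y⁆.2 0 =
      2 * (x1 * y5 - x5 * y1) - 2 * (x2 * y4 - x4 * y2) := by
    subst_vars
    simp only [bracket_snd, Pi.add_apply, Pi.smul_apply, smul_eq_mul,
      cross_apply, Matrix.cons_val]
    ring_nf
  have hz4 : (⁅X, Y⁆.2 1 - Complex.I * ⁅X, Y⁆.2 2) / 2 =
      (x0 * y4 - x4 * y0) - (x1 * y3 - x3 * y1) := by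
    subst_vars
    simp only [bracket_snd, Pi.add_apply, Pi.smul_apply, smul_eq_mul,
      cross_apply, Matrix.cons_val]
    ring_nf
    simp only [Complex.I_sq]
    ring
  have hz5 : (⁅X, Y⁆.2 1 + Complex.I * ⁅X, Y⁆.2 2) / 2 =
      -(x0 * y5 - x5 * y0) + (x2 * y3 - x3 * y2) := by
    subst_vars
    simp only [bracket_snd, Pi.add_apply, Pi.smul_apply, smul_eq_mul,
      cross_apply, Matrix.cons_val]
    ring_nf
    simp only [Complex.I_sq]
    ring
  rw [op_eq, op_eq, op_eq, hz0, hz1, hz2, hz3, hz4, hz5, ← hx0, ← hx1, ← hx2, ← hx3, ← hx4, ← hx5,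
    ← hy0, ← hy1, ← hy2, ← hy3, ← hy4, ← hy5]
  simp only [mul_add, add_mul, smul_mul_assoc, mul_smul_comm]
  linear_combination (norm := module) (-1 : ℂ) • (
      (x0 * y1 - x1 * y0) • G.J0_Jp + (x0 * y2 - x2 * y0) • G.J0_Jm + (x1 * y2 - x2 * y1) •
      G.Jp_Jm + (x0 * y3 - x3 * y0) • G.J0_K0 + (x0 * y4 - x4 * y0) • G.J0_Kp + (x0 * y5 -
      x5 * y0) • G.J0_Km + (x1 * y3 - x3 * y1) • G.Jp_K0 + (x1 * y4 - x4 * y1) • G.Jp_Kp +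
      (x1 * y5 - x5 * y1) • G.Jp_Km + (x2 * y3 - x3 * y2) • G.Jm_K0 + (x2 * y4 - x4 * y2) •
      G.Jm_Kp + (x2 * y5 - x5 * y2) • G.Jm_Km + (x3 * y4 - x4 * y3) • G.K0_Kp + (x3 * y5 -
      x5 * y3) • G.K0_Km + (x4 * y5 - x5 * y4) • G.Kp_Km)

/-- The module structure given by a choice of generators. -/
@[reducible]
def lieRingModule : LieRingModule LorentzAlgebra E where
  bracket X v := G.op X v
  add_lie X Y v := by simp
  lie_add X v w := by simp
  leibniz_lie X Y v := by simp [op_lie]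

theorem lieModule : @LieModule ℂ LorentzAlgebra E _ _ _ _ _ G.lieRingModule :=
  letI := G.lieRingModule
  { smul_lie := fun c X v => by
      change G.op (c • X) v = c • G.op X v
      simp
    lie_smul := fun c X v => by
      change G.op X (c • v) = c • G.op X v
      simp }

end Generators

end LorentzAlgebra

/-! ### Sums of spin-`j` representations and boost generators on them -/

/-- Labels `(j, m)` of the basis vectors `|j, m⟩` with `2 j ∈ S` and `m ∈ {-j, -j + 1, …, j}`,
stored as the pair of nonnegative integers `(p, q) = (j + m, j - m)`. -/
def SpinIndex (S : Set ℤ) : Type := {x : ℤ × ℤ // 0 ≤ x.1 ∧ 0 ≤ x.2 ∧ x.1 + x.2 ∈ S}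

/-- The algebraic direct sum over `2 j ∈ S` of the `(2 j + 1)`-dimensional spaces with basis
`|j, m⟩`. -/
abbrev SpinSpace (S : Set ℤ) : Type := SpinIndex S →₀ ℂ

namespace SpinSpace

variable {S : Set ℤ}

open Classical in
/-- The vector `|j, m⟩` with `j + m = p`, `j - m = q`; it is `0` if there is no such basis
vector. -/
def ket (S : Set ℤ) (p q : ℤ) : SpinSpace S :=
  if h : 0 ≤ p ∧ 0 ≤ q ∧ p + q ∈ S then Finsupp.single ⟨(p, q), h⟩ 1 else 0

/-- The operator sending `|j, m⟩` to `f p q`, where `p = j + m`, `q = j - m`. -/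
def ofKets (f : ℤ → ℤ → SpinSpace S) : Module.End ℂ (SpinSpace S) :=
  Finsupp.linearCombination ℂ fun x : SpinIndex S => f x.1.1 x.1.2

/-- The value of `j` on `(p, q) = (j + m, j - m)`. -/
def jval (p q : ℤ) : ℂ := ((p : ℂ) + q) / 2

/-- The value of `m` on `(p, q) = (j + m, j - m)`. -/
def mval (p q : ℤ) : ℂ := ((p : ℂ) - q) / 2

/-- `J_0 |j, m⟩ = m |j, m⟩`. -/
def J0 (S : Set ℤ) : Module.End ℂ (SpinSpace S) :=
  ofKets fun p q => mval p q • ket S p q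

/-- `C_+(j, m) = √(j - m) √(j + m + 1)`. -/
def Cp (j m : ℂ) : ℂ := Complex.sqrt (j - m) * Complex.sqrt (j + m + 1)

/-- `C_-(j, m) = √(j + m) √(j - m + 1)`. -/
def Cm (j m : ℂ) : ℂ := Complex.sqrt (j + m) * Complex.sqrt (j - m + 1)

/-- `J_+ |j, m⟩ = C_+(j, m) |j, m + 1⟩`. -/
def Jp (S : Set ℤ) : Module.End ℂ (SpinSpace S) :=
  ofKets fun p q => Cp (jval p q) (mval p q) • ket S (p + 1) (q - 1)

/-- `J_- |j, m⟩ = C_-(j, m) |j, m - 1⟩`. -/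
def Jm (S : Set ℤ) : Module.End ℂ (SpinSpace S) :=
  ofKets fun p q => Cm (jval p q) (mval p q) • ket S (p - 1) (q + 1)

/-- The operator `K_0` with reduced matrix elements `P^+(j) = P^-(j + 1)`, `P(j)`, `P^-(j)`:
its components on `|j + 1, m⟩`, `|j, m⟩`, `|j - 1, m⟩`. -/
def K0 (S : Set ℤ) (P Pm : ℂ → ℂ) : Module.End ℂ (SpinSpace S) :=
  ofKets fun p q =>
    let j := jval p q
    let m := mval p q
    (Pm (j + 1) * (Complex.sqrt (j + m + 1) * Complex.sqrt (j - m + 1))) • ket S (p + 1) (q + 1)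
      + (P j * m) • ket S p q
      + (Pm j * (Complex.sqrt (j + m) * Complex.sqrt (j - m))) • ket S (p - 1) (q - 1)

/-- The operator `K_+` with reduced matrix elements `P^+(j) = P^-(j + 1)`, `P(j)`, `P^-(j)`:
its components on `|j + 1, m + 1⟩`, `|j, m + 1⟩`, `|j - 1, m + 1⟩`. -/
def Kp (S : Set ℤ) (P Pm : ℂ → ℂ) : Module.End ℂ (SpinSpace S) :=
  ofKets fun p q =>
    let j := jval p q
    let m := mval p q
    (-Pm (j + 1) * (Complex.sqrt (j + m + 1) * Complex.sqrt (j + m + 2))) • ket S (p + 2) q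
      + (P j * Cp j m) • ket S (p + 1) (q - 1)
      + (Pm j * (Complex.sqrt (j - m) * Complex.sqrt (j - m - 1))) • ket S p (q - 2)

/-- The operator `K_-` with reduced matrix elements `P^+(j) = P^-(j + 1)`, `P(j)`, `P^-(j)`:
its components on `|j + 1, m - 1⟩`, `|j, m - 1⟩`, `|j - 1, m - 1⟩`. -/
def Km (S : Set ℤ) (P Pm : ℂ → ℂ) : Module.End ℂ (SpinSpace S) :=
  ofKets fun p q =>
    let j := jval p q
    let m := mval p q
    (Pm (j + 1) * (Complex.sqrt (j - m + 1) * Complex.sqrt (j - m + 2))) • ket S p (q + 2)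
      + (P j * Cm j m) • ket S (p - 1) (q + 1)
      + (-Pm j * (Complex.sqrt (j + m) * Complex.sqrt (j + m - 1))) • ket S (p - 2) q

/-- The conditions on reduced matrix elements under which the operators above close into the
Lorentz algebra. -/
structure IsReduced (S : Set ℤ) (P Pm : ℂ → ℂ) : Prop where
  boundary : ∀ n : ℤ, ¬(n ∈ S ↔ n + 2 ∈ S) → Pm ((n : ℂ) / 2 + 1) = 0
  recur : ∀ n ∈ S, n + 2 ∈ S →
    ((n : ℂ) / 2) * P ((n : ℂ) / 2) = ((n : ℂ) / 2 + 2) * P ((n : ℂ) / 2 + 1)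
  norm : ∀ n ∈ S, n ≠ 0 →
    -(n + 3) * Pm ((n : ℂ) / 2 + 1) ^ 2 + (n - 1) * Pm ((n : ℂ) / 2) ^ 2 + P ((n : ℂ) / 2) ^ 2 = -1

theorem ket_of_not {p q : ℤ} (h : ¬(0 ≤ p ∧ 0 ≤ q ∧ p + q ∈ S)) : ket S p q = 0 := dif_neg h

theorem ket_index (x : SpinIndex S) : ket S x.1.1 x.1.2 = Finsupp.single x 1 := dif_pos x.2

theorem ofKets_ket (f : ℤ → ℤ → SpinSpace S) (p q : ℤ)
    (h : ¬(0 ≤ p ∧ 0 ≤ q ∧ p + q ∈ S) → f p q = 0) : ofKets f (ket S p q) = f p q := by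
  by_cases hx : 0 ≤ p ∧ 0 ≤ q ∧ p + q ∈ S
  · rw [ket, dif_pos hx]
    exact (Finsupp.linearCombination_single ℂ 1 _).trans (one_smul ℂ _)
  · rw [ket_of_not hx, h hx, map_zero]

theorem end_ext {A B : Module.End ℂ (SpinSpace S)}
    (h : ∀ p q, 0 ≤ p → 0 ≤ q → p + q ∈ S → A (ket S p q) = B (ket S p q)) : A = B := by
  refine Finsupp.lhom_ext' fun x => LinearMap.ext_ring ?_
  simpa [ket_index] using h x.1.1 x.1.2 x.2.1 x.2.2.1 x.2.2.2

theorem csqrt_sq (z : ℂ) : Complex.sqrt z ^ 2 = z := by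
  simp [Complex.sqrt, ← Complex.cpow_nat_mul]

theorem J0_ket (p q : ℤ) : J0 S (ket S p q) = (((p : ℂ) - q) / 2) • ket S p q :=
  ofKets_ket _ p q fun h => by simp [ket_of_not h]

theorem smul_ket_eq_zero {c : ℂ} {p q p' q' : ℤ} (h : ¬(0 ≤ p ∧ 0 ≤ q ∧ p + q ∈ S))
    (hc : 0 ≤ p' → 0 ≤ q' → p' + q' ∈ S → ¬(0 ≤ p ∧ 0 ≤ q ∧ p + q ∈ S) → c = 0) :
    c • ket S p' q' = 0 := by
  by_cases h' : 0 ≤ p' ∧ 0 ≤ q' ∧ p' + q' ∈ S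
  · rw [hc h'.1 h'.2.1 h'.2.2 h, zero_smul]
  · rw [ket_of_not h', smul_zero]

theorem Jp_ket (p q : ℤ) : Jp S (ket S p q) =
    (Complex.sqrt q * Complex.sqrt (p + 1)) • ket S (p + 1) (q - 1) := by
  have e : (Complex.sqrt q * Complex.sqrt (p + 1)) = Cp (jval p q) (mval p q) := by
    simp only [Cp, jval, mval]; congr 2 <;> ring
  rw [e, Jp]
  refine ofKets_ket _ p q fun h => smul_ket_eq_zero h fun h1 h2 h3 h4 => ?_
  have : p = -1 := by
    by_contra hp
    exact h ⟨by omega, by omega, by convert h3 using 1; ring⟩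
  subst this
  rw [← e]; simp

theorem Jm_ket (p q : ℤ) : Jm S (ket S p q) =
    (Complex.sqrt p * Complex.sqrt (q + 1)) • ket S (p - 1) (q + 1) := by
  have e : (Complex.sqrt p * Complex.sqrt (q + 1)) = Cm (jval p q) (mval p q) := by
    simp only [Cm, jval, mval]; congr 2 <;> ring
  rw [e, Jm]
  refine ofKets_ket _ p q fun h => smul_ket_eq_zero h fun h1 h2 h3 h4 => ?_
  have : q = -1 := by
    by_contra hp
    exact h ⟨by omega, by omega, by convert h3 using 1; ring⟩
  subst this
  rw [← e]; simp

variable {P Pm : ℂ → ℂ}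

theorem IsReduced.up (hP : IsReduced S P Pm) {p q : ℤ} (h1 : p + q ∉ S) (h2 : p + q + 2 ∈ S) :
    Pm ((p + q : ℂ) / 2 + 1) = 0 := by
  have := hP.boundary (p + q) (by tauto)
  rwa [Int.cast_add] at this

theorem IsReduced.down (hP : IsReduced S P Pm) {p q : ℤ} (h1 : p + q ∉ S) (h2 : p + q - 2 ∈ S) :
    Pm ((p + q : ℂ) / 2) = 0 := by
  have := hP.boundary (p + q - 2) (by simp [h1, h2])
  push_cast at this
  rw [← this]; congr 1; ring

theorem IsReduced.boundary' (hP : IsReduced S P Pm) {p q : ℤ} (h1 : p + q ∈ S)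
    (h2 : p + q - 2 ∉ S) : Pm ((p + q : ℂ) / 2) = 0 := by
  have := hP.boundary (p + q - 2) (by simp [h1, h2])
  push_cast at this
  rw [← this]; congr 1; ring

theorem K0_ket (hP : IsReduced S P Pm) (p q : ℤ) : K0 S P Pm (ket S p q) =
    (Pm ((p + q : ℂ) / 2 + 1) * (Complex.sqrt (p + 1) * Complex.sqrt (q + 1))) •
        ket S (p + 1) (q + 1)
      + (P ((p + q : ℂ) / 2) * (((p : ℂ) - q) / 2)) • ket S p q
      + (Pm ((p + q : ℂ) / 2) * (Complex.sqrt p * Complex.sqrt q)) • ket S (p - 1) (q - 1) := by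
  have e1 : jval p q + mval p q = p := by simp only [jval, mval]; ring
  have e2 : jval p q - mval p q = q := by simp only [jval, mval]; ring
  rw [K0, ofKets_ket]
  · simp only [e1, e2]; rfl
  · intro h
    simp only [e1, e2]
    rw [ket_of_not h, smul_zero, add_zero]
    have a1 : (Pm (jval p q + 1) * (Complex.sqrt (p + 1) * Complex.sqrt (q + 1))) •
        ket S (p + 1) (q + 1) = 0 := smul_ket_eq_zero h fun h1 h2 h3 h4 => by
      rcases eq_or_ne p (-1) with rfl | hp
      · simp
      rcases eq_or_ne q (-1) with rfl | hq
      · simp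
      rw [jval, hP.up (fun hs => h ⟨by omega, by omega, hs⟩) (by convert h3 using 1; ring), zero_mul]
    have a2 : (Pm (jval p q) * (Complex.sqrt p * Complex.sqrt q)) •
        ket S (p - 1) (q - 1) = 0 := smul_ket_eq_zero h fun h1 h2 h3 h4 => by
      rw [jval, hP.down (fun hs => h ⟨by omega, by omega, hs⟩) (by convert h3 using 1; ring),
        zero_mul]
    rw [a1, a2, add_zero]

theorem Kp_ket (hP : IsReduced S P Pm) (p q : ℤ) : Kp S P Pm (ket S p q) =
    (-Pm ((p + q : ℂ) / 2 + 1) * (Complex.sqrt (p + 1) * Complex.sqrt (p + 2))) • ket S (p + 2) q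
      + (P ((p + q : ℂ) / 2) * (Complex.sqrt q * Complex.sqrt (p + 1))) • ket S (p + 1) (q - 1)
      + (Pm ((p + q : ℂ) / 2) * (Complex.sqrt q * Complex.sqrt (q - 1))) • ket S p (q - 2) := by
  have e1 : jval p q + mval p q = p := by simp only [jval, mval]; ring
  have e2 : jval p q - mval p q = q := by simp only [jval, mval]; ring
  rw [Kp, ofKets_ket]
  · simp only [Cp, e1, e2]; rfl
  · intro h
    simp only [Cp, e1, e2]
    have a1 : (-Pm (jval p q + 1) * (Complex.sqrt (p + 1) * Complex.sqrt (p + 2))) •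
        ket S (p + 2) q = 0 := smul_ket_eq_zero h fun h1 h2 h3 h4 => by
      rcases eq_or_ne p (-1) with rfl | hp
      · simp
      rcases eq_or_ne p (-2) with rfl | hq
      · simp
      rw [jval, hP.up (fun hs => h ⟨by omega, by omega, hs⟩) (by convert h3 using 1; ring)]
      simp
    have a0 : (P (jval p q) * (Complex.sqrt q * Complex.sqrt (p + 1))) •
        ket S (p + 1) (q - 1) = 0 := smul_ket_eq_zero h fun h1 h2 h3 h4 => by
      rcases eq_or_ne p (-1) with rfl | hp
      · simp
      exact absurd ⟨by omega, by omega, by convert h3 using 1; ring⟩ h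
    have a2 : (Pm (jval p q) * (Complex.sqrt q * Complex.sqrt (q - 1))) •
        ket S p (q - 2) = 0 := smul_ket_eq_zero h fun h1 h2 h3 h4 => by
      rw [jval, hP.down (fun hs => h ⟨by omega, by omega, hs⟩) (by convert h3 using 1; ring),
        zero_mul]
    rw [a1, a0, a2, add_zero, add_zero]

theorem Km_ket (hP : IsReduced S P Pm) (p q : ℤ) : Km S P Pm (ket S p q) =
    (Pm ((p + q : ℂ) / 2 + 1) * (Complex.sqrt (q + 1) * Complex.sqrt (q + 2))) • ket S p (q + 2)
      + (P ((p + q : ℂ) / 2) * (Complex.sqrt p * Complex.sqrt (q + 1))) • ket S (p - 1) (q + 1)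
      + (-Pm ((p + q : ℂ) / 2) * (Complex.sqrt p * Complex.sqrt (p - 1))) • ket S (p - 2) q := by
  have e1 : jval p q + mval p q = p := by simp only [jval, mval]; ring
  have e2 : jval p q - mval p q = q := by simp only [jval, mval]; ring
  rw [Km, ofKets_ket]
  · simp only [Cm, e1, e2]; rfl
  · intro h
    simp only [Cm, e1, e2]
    have a1 : (Pm (jval p q + 1) * (Complex.sqrt (q + 1) * Complex.sqrt (q + 2))) •
        ket S p (q + 2) = 0 := smul_ket_eq_zero h fun h1 h2 h3 h4 => by
      rcases eq_or_ne q (-1) with rfl | hp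
      · simp
      rcases eq_or_ne q (-2) with rfl | hq
      · simp
      rw [jval, hP.up (fun hs => h ⟨by omega, by omega, hs⟩) (by convert h3 using 1; ring)]
      simp
    have a0 : (P (jval p q) * (Complex.sqrt p * Complex.sqrt (q + 1))) •
        ket S (p - 1) (q + 1) = 0 := smul_ket_eq_zero h fun h1 h2 h3 h4 => by
      rcases eq_or_ne q (-1) with rfl | hp
      · simp
      exact absurd ⟨by omega, by omega, by convert h3 using 1; ring⟩ h
    have a2 : (-Pm (jval p q) * (Complex.sqrt p * Complex.sqrt (p - 1))) •
        ket S (p - 2) q = 0 := smul_ket_eq_zero h fun h1 h2 h3 h4 => by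
      rw [jval, hP.down (fun hs => h ⟨by omega, by omega, hs⟩) (by convert h3 using 1; ring)]
      simp
    rw [a1, a0, a2, add_zero, add_zero]

theorem J0_Jp : J0 S * Jp S - Jp S * J0 S = Jp S := by
  refine end_ext fun p q hp hq hpq => ?_
  simp only [LinearMap.sub_apply, LinearMap.neg_apply, LinearMap.smul_apply, LinearMap.zero_apply,
    Module.End.mul_apply, J0_ket, Jp_ket, map_add, map_smul, Int.cast_add, Int.cast_sub, Int.cast_one,
    Int.cast_ofNat]
  ring_nf
  try match_scalars
  all_goals (ring_nf; try simp only [csqrt_sq]; try ring)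

theorem J0_Jm : J0 S * Jm S - Jm S * J0 S = -Jm S := by
  refine end_ext fun p q hp hq hpq => ?_
  simp only [LinearMap.sub_apply, LinearMap.neg_apply, LinearMap.smul_apply, LinearMap.zero_apply,
    Module.End.mul_apply, J0_ket, Jm_ket, map_add, map_smul, Int.cast_add, Int.cast_sub, Int.cast_one,
    Int.cast_ofNat]
  ring_nf
  try match_scalars
  all_goals (ring_nf; try simp only [csqrt_sq]; try ring)

theorem Jp_Jm : Jp S * Jm S - Jm S * Jp S = (2 : ℂ) • J0 S := by
  refine end_ext fun p q hp hq hpq => ?_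
  simp only [LinearMap.sub_apply, LinearMap.neg_apply, LinearMap.smul_apply, LinearMap.zero_apply,
    Module.End.mul_apply, J0_ket, Jm_ket, Jp_ket, map_add, map_smul, Int.cast_add, Int.cast_sub, Int.cast_one,
    Int.cast_ofNat]
  ring_nf
  try match_scalars
  all_goals (ring_nf; try simp only [csqrt_sq]; try ring)

theorem J0_K0 (hP : IsReduced S P Pm) : J0 S * K0 S P Pm - K0 S P Pm * J0 S = 0 := by
  refine end_ext fun p q hp hq hpq => ?_
  simp only [LinearMap.sub_apply, LinearMap.neg_apply, LinearMap.smul_apply, LinearMap.zero_apply,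
    Module.End.mul_apply, J0_ket, K0_ket hP, map_add, map_smul, Int.cast_add, Int.cast_sub, Int.cast_one,
    Int.cast_ofNat]
  ring_nf
  try match_scalars
  all_goals (ring_nf; try simp only [csqrt_sq]; try ring)

theorem J0_Kp (hP : IsReduced S P Pm) : J0 S * Kp S P Pm - Kp S P Pm * J0 S = Kp S P Pm := by
  refine end_ext fun p q hp hq hpq => ?_
  simp only [LinearMap.sub_apply, LinearMap.neg_apply, LinearMap.smul_apply, LinearMap.zero_apply,
    Module.End.mul_apply, J0_ket, Kp_ket hP, map_add, map_smul, Int.cast_add, Int.cast_sub, Int.cast_one,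
    Int.cast_ofNat]
  ring_nf
  try match_scalars
  all_goals (ring_nf; try simp only [csqrt_sq]; try ring)

theorem J0_Km (hP : IsReduced S P Pm) : J0 S * Km S P Pm - Km S P Pm * J0 S = -Km S P Pm := by
  refine end_ext fun p q hp hq hpq => ?_
  simp only [LinearMap.sub_apply, LinearMap.neg_apply, LinearMap.smul_apply, LinearMap.zero_apply,
    Module.End.mul_apply, J0_ket, Km_ket hP, map_add, map_smul, Int.cast_add, Int.cast_sub, Int.cast_one,
    Int.cast_ofNat]
  ring_nf
  try match_scalars
  all_goals (ring_nf; try simp only [csqrt_sq]; try ring)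

theorem Jp_K0 (hP : IsReduced S P Pm) : Jp S * K0 S P Pm - K0 S P Pm * Jp S = -Kp S P Pm := by
  refine end_ext fun p q hp hq hpq => ?_
  simp only [LinearMap.sub_apply, LinearMap.neg_apply, LinearMap.smul_apply, LinearMap.zero_apply,
    Module.End.mul_apply, Jp_ket, K0_ket hP, Kp_ket hP, map_add, map_smul, Int.cast_add, Int.cast_sub, Int.cast_one,
    Int.cast_ofNat]
  ring_nf
  try match_scalars
  all_goals (ring_nf; try simp only [csqrt_sq]; try ring)

theorem Jp_Kp (hP : IsReduced S P Pm) : Jp S * Kp S P Pm - Kp S P Pm * Jp S = 0 := by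
  refine end_ext fun p q hp hq hpq => ?_
  simp only [LinearMap.sub_apply, LinearMap.neg_apply, LinearMap.smul_apply, LinearMap.zero_apply,
    Module.End.mul_apply, Jp_ket, Kp_ket hP, map_add, map_smul, Int.cast_add, Int.cast_sub, Int.cast_one,
    Int.cast_ofNat]
  ring_nf
  try match_scalars
  all_goals (ring_nf; try simp only [csqrt_sq]; try ring)

theorem Jp_Km (hP : IsReduced S P Pm) : Jp S * Km S P Pm - Km S P Pm * Jp S = (2 : ℂ) • K0 S P Pm := by
  refine end_ext fun p q hp hq hpq => ?_
  simp only [LinearMap.sub_apply, LinearMap.neg_apply, LinearMap.smul_apply, LinearMap.zero_apply,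
    Module.End.mul_apply, Jp_ket, K0_ket hP, Km_ket hP, map_add, map_smul, Int.cast_add, Int.cast_sub, Int.cast_one,
    Int.cast_ofNat]
  ring_nf
  try match_scalars
  all_goals (ring_nf; try simp only [csqrt_sq]; try ring)

theorem Jm_K0 (hP : IsReduced S P Pm) : Jm S * K0 S P Pm - K0 S P Pm * Jm S = Km S P Pm := by
  refine end_ext fun p q hp hq hpq => ?_
  simp only [LinearMap.sub_apply, LinearMap.neg_apply, LinearMap.smul_apply, LinearMap.zero_apply,
    Module.End.mul_apply, Jm_ket, K0_ket hP, Km_ket hP, map_add, map_smul, Int.cast_add, Int.cast_sub, Int.cast_one,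
    Int.cast_ofNat]
  ring_nf
  try match_scalars
  all_goals (ring_nf; try simp only [csqrt_sq]; try ring)

theorem Jm_Kp (hP : IsReduced S P Pm) : Jm S * Kp S P Pm - Kp S P Pm * Jm S = -((2 : ℂ) • K0 S P Pm) := by
  refine end_ext fun p q hp hq hpq => ?_
  simp only [LinearMap.sub_apply, LinearMap.neg_apply, LinearMap.smul_apply, LinearMap.zero_apply,
    Module.End.mul_apply, Jm_ket, K0_ket hP, Kp_ket hP, map_add, map_smul, Int.cast_add, Int.cast_sub, Int.cast_one,
    Int.cast_ofNat]
  ring_nf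
  try match_scalars
  all_goals (ring_nf; try simp only [csqrt_sq]; try ring)

theorem Jm_Km (hP : IsReduced S P Pm) : Jm S * Km S P Pm - Km S P Pm * Jm S = 0 := by
  refine end_ext fun p q hp hq hpq => ?_
  simp only [LinearMap.sub_apply, LinearMap.neg_apply, LinearMap.smul_apply, LinearMap.zero_apply,
    Module.End.mul_apply, Jm_ket, Km_ket hP, map_add, map_smul, Int.cast_add, Int.cast_sub, Int.cast_one,
    Int.cast_ofNat]
  ring_nf
  try match_scalars
  all_goals (ring_nf; try simp only [csqrt_sq]; try ring)

theorem IsReduced.recur_up (hP : IsReduced S P Pm) {p q : ℤ} (h : p + q ∈ S) :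
    Pm ((p + q : ℂ) / 2 + 1) * (((p + q : ℂ) / 2 + 2) * P ((p + q : ℂ) / 2 + 1)
      - ((p + q : ℂ) / 2) * P ((p + q : ℂ) / 2)) = 0 := by
  by_cases h2 : p + q + 2 ∈ S
  · have := hP.recur _ h h2
    push_cast at this
    rw [this]; ring
  · have := hP.boundary (p + q) (by tauto)
    push_cast at this
    rw [this, zero_mul]

theorem IsReduced.recur_down (hP : IsReduced S P Pm) {p q : ℤ} (h : p + q ∈ S) :
    Pm ((p + q : ℂ) / 2) * (((p + q : ℂ) / 2 + 1) * P ((p + q : ℂ) / 2)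
      - ((p + q : ℂ) / 2 - 1) * P ((p + q : ℂ) / 2 - 1)) = 0 := by
  by_cases h2 : p + q - 2 ∈ S
  · have := hP.recur _ h2 (by simpa using h)
    push_cast at this
    have e1 : ((p + q - 2 : ℂ)) / 2 = (p + q : ℂ) / 2 - 1 := by ring
    have e2 : (p + q : ℂ) / 2 - 1 + 1 = (p + q : ℂ) / 2 := by ring
    rw [e1, e2] at this
    rw [this]; ring
  · rw [hP.boundary' h h2, zero_mul]

theorem IsReduced.norm' (hP : IsReduced S P Pm) {p q : ℤ} (hp : 0 ≤ p) (hq : 0 ≤ q)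
    (h : p + q ∈ S) : ((p : ℂ) - q) * (-(p + q + 3) * Pm ((p + q : ℂ) / 2 + 1) ^ 2
      + (p + q - 1) * Pm ((p + q : ℂ) / 2) ^ 2 + P ((p + q : ℂ) / 2) ^ 2 + 1) = 0 := by
  by_cases h0 : p + q = 0
  · have h1 : p = 0 := by omega
    have h2 : q = 0 := by omega
    simp [h1, h2]
  · have := hP.norm _ h h0
    push_cast at this
    rw [this]; ring

theorem Kp_Km (hP : IsReduced S P Pm) : Kp S P Pm * Km S P Pm - Km S P Pm * Kp S P Pm = -((2 : ℂ) • J0 S) := by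
  refine end_ext fun p q hp hq hpq => ?_
  have hA := hP.recur_up hpq
  have hB := hP.recur_down hpq
  have hC := hP.norm' hp hq hpq
  simp only [LinearMap.sub_apply, LinearMap.neg_apply, LinearMap.smul_apply, LinearMap.zero_apply,
    Module.End.mul_apply, J0_ket, Kp_ket hP, Km_ket hP, map_add, map_smul, Int.cast_add, Int.cast_sub, Int.cast_one,
    Int.cast_ofNat]
  ring_nf
  match_scalars
  all_goals ring_nf
  all_goals simp only [csqrt_sq]
  all_goals ring_nf
  · linear_combination (norm := ring_nf)
      2 * Complex.sqrt (1 + q) * Complex.sqrt (1 + p) * hA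
  · linear_combination (norm := ring_nf) hC
  · linear_combination (norm := ring_nf) 2 * Complex.sqrt p * Complex.sqrt q * hB


theorem comm_neg {E : Type*} [AddCommGroup E] [Module ℂ E] {a b c : Module.End ℂ E}
    (h : a * b - b * a = c) : b * a - a * b = -c := by rw [← h, neg_sub]

/-- Jacobi identity for `a`, `b`, `c`. -/
theorem jacobi_aux {E : Type*} [AddCommGroup E] [Module ℂ E] {a b c d e : Module.End ℂ E}
    (hab : a * b - b * a = 0) (hbc : b * c - c * b = -((2 : ℂ) • e))
    (hac : a * c - c * a = (2 : ℂ) • d) (hae : a * e - e * a = -a) : d * b - b * d = -a := by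
  have h : a * (b * c - c * b) - (b * c - c * b) * a
      = (a * b - b * a) * c - c * (a * b - b * a) + (b * (a * c - c * a) - (a * c - c * a) * b) := by
    noncomm_ring
  rw [hab, hbc, hac] at h
  simp only [mul_neg, neg_mul, mul_smul_comm, smul_mul_assoc, zero_mul, mul_zero] at h
  have h2 : (2 : ℂ) • (d * b - b * d) = (2 : ℂ) • (a * e - e * a) := by
    rw [smul_sub, smul_sub]
    linear_combination (norm := module) h
  rw [← hae]
  exact smul_right_injective _ (two_ne_zero : (2 : ℂ) ≠ 0) h2

/-- Jacobi identity for `a`, `b`, `c`. -/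
theorem jacobi_aux' {E : Type*} [AddCommGroup E] [Module ℂ E] {a b c d e : Module.End ℂ E}
    (hab : a * b - b * a = 0) (hcb : c * b - b * c = -((2 : ℂ) • e))
    (hac : a * c - c * a = -((2 : ℂ) • d)) (hea : e * a - a * e = -a) : d * b - b * d = a := by
  have h := jacobi_aux (d := -d) (e := -e) hab ((comm_neg hcb).trans (by simp))
    (hac.trans (by simp)) (by rw [mul_neg, neg_mul, neg_sub_neg, hea])
  rw [neg_mul, mul_neg, neg_sub_neg] at h
  exact (comm_neg h).trans (neg_neg _)

theorem K0_Kp (hP : IsReduced S P Pm) : K0 S P Pm * Kp S P Pm - Kp S P Pm * K0 S P Pm = -Jp S := by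
  exact jacobi_aux (Jp_Kp hP) (Kp_Km hP) (Jp_Km hP) (comm_neg J0_Jp)

theorem K0_Km (hP : IsReduced S P Pm) : K0 S P Pm * Km S P Pm - Km S P Pm * K0 S P Pm = Jm S := 
  jacobi_aux' (Jm_Km hP) (Kp_Km hP) (Jm_Kp hP) J0_Jm

/-- The generators acting on the sum of spin-`j` representations with `2 j ∈ S`, with reduced
matrix elements `P^+(j) = P^-(j + 1)`, `P(j)`, `P^-(j)` of the boosts. -/
def generators (hP : IsReduced S P Pm) : LorentzAlgebra.Generators (SpinSpace S) where
  J0 := J0 S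
  Jp := Jp S
  Jm := Jm S
  K0 := K0 S P Pm
  Kp := Kp S P Pm
  Km := Km S P Pm
  J0_Jp := J0_Jp
  J0_Jm := J0_Jm
  Jp_Jm := Jp_Jm
  J0_K0 := J0_K0 hP
  J0_Kp := J0_Kp hP
  J0_Km := J0_Km hP
  Jp_K0 := Jp_K0 hP
  Jp_Kp := Jp_Kp hP
  Jp_Km := Jp_Km hP
  Jm_K0 := Jm_K0 hP
  Jm_Kp := Jm_Kp hP
  Jm_Km := Jm_Km hP
  K0_Kp := K0_Kp hP
  K0_Km := K0_Km hP
  Kp_Km := Kp_Km hP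

end SpinSpace

/-! ### The modules `F^A_γ`, `(γ₁, γ₂)` and `V_{λ,ρ}` -/

theorem isReduced_chiral (A : ℤˣ) (g : ℕ) :
    SpinSpace.IsReduced {(g : ℤ)} (fun _ => Complex.I * ((A : ℤ) : ℂ)) (fun _ => 0) where
  boundary _ _ := rfl
  recur n h1 h2 := by
    simp only [Set.mem_singleton_iff] at h1 h2
    omega
  norm n _ _ := by
    have h : (((A : ℤ) : ℂ)) ^ 2 = 1 := by
      rcases Int.units_eq_one_or A with rfl | rfl <;> simp
    rw [mul_pow, h, Complex.I_sq]
    ring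

/-- The module `F^A_γ`, `γ = g / 2`, `A = ±1`: the spin-`γ` representation of the `J`s with basis
`|γ_A, μ⟩`, on which `K_a` acts as `i A J_a`. -/
def ChiralModule (_A : ℤˣ) (g : ℕ) : Type := SpinSpace {(g : ℤ)}

namespace ChiralModule

variable (A : ℤˣ) (g : ℕ)

instance : AddCommGroup (ChiralModule A g) := inferInstanceAs (AddCommGroup (SpinSpace {(g : ℤ)}))
instance : Module ℂ (ChiralModule A g) := inferInstanceAs (Module ℂ (SpinSpace {(g : ℤ)}))
instance : LieRingModule LorentzAlgebra (ChiralModule A g) :=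
  (SpinSpace.generators (isReduced_chiral A g)).lieRingModule
instance : LieModule ℂ LorentzAlgebra (ChiralModule A g) :=
  (SpinSpace.generators (isReduced_chiral A g)).lieModule

/-- The basis `|γ_A, μ⟩`, `μ ∈ {-γ, …, γ}`. -/
def basis : Module.Basis (SpinIndex {(g : ℤ)}) ℂ (ChiralModule A g) :=
  (Finsupp.basisSingleOne : Module.Basis (SpinIndex {(g : ℤ)}) ℂ (SpinSpace {(g : ℤ)}))

end ChiralModule

/-- The irreducible finite-dimensional module `(γ₁, γ₂) = F^-_{γ₁} ⊗ F^+_{γ₂}`, where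
`γ₁ = g₁ / 2`, `γ₂ = g₂ / 2`. -/
abbrev FiniteLorentzModule (g₁ g₂ : ℕ) : Type := ChiralModule (-1) g₁ ⊗[ℂ] ChiralModule 1 g₂

/-- `P^-_{λ,ρ}(j)`. -/
def lorentzPm (lam rho j : ℂ) : ℂ :=
  (Complex.sqrt (j + lam) * Complex.sqrt (j - lam) * Complex.sqrt (j + rho) * Complex.sqrt (j - rho))
    / (j * Complex.sqrt (2 * j + 1) * Complex.sqrt (2 * j - 1))

open Classical in
/-- `P_{λ,ρ}(j)`. -/
def lorentzP (lam rho j : ℂ) : ℂ :=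
  if j = 0 then 0 else Complex.I * lam * rho / (j * (j + 1))

/-- The set of all `2 j` such that the spin `j` occurs in `V_{λ,ρ}`, `λ = l / 2`:
`j = |λ| + k`, where `P^+_{λ,ρ}(j') = P^-_{λ,ρ}(j' + 1)` does not vanish for
`j' = |λ|, …, |λ| + k - 1`. -/
def lorentzSpins (l : ℤ) (rho : ℂ) : Set ℤ :=
  {n | ∃ k : ℕ, n = |l| + 2 * k ∧
    ∀ i < k, lorentzPm ((l : ℂ) / 2) rho (((|l| : ℤ) : ℂ) / 2 + i + 1) ≠ 0}

theorem lorentzPm_sq (lam rho j : ℂ) : lorentzPm lam rho j ^ 2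
    = ((j ^ 2 - lam ^ 2) * (j ^ 2 - rho ^ 2)) / (j ^ 2 * ((2 * j + 1) * (2 * j - 1))) := by
  rw [lorentzPm, div_pow]
  simp only [mul_pow, SpinSpace.csqrt_sq]
  congr 1 <;> ring

theorem lorentzP_eq (lam rho j : ℂ) :
    lorentzP lam rho j = Complex.I * lam * rho / (j * (j + 1)) := by
  rw [lorentzP]
  split_ifs with h <;> simp [h]

theorem lorentzPm_abs (l : ℤ) (rho : ℂ) :
    lorentzPm ((l : ℂ) / 2) rho (((|l| : ℤ) : ℂ) / 2) = 0 := by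
  rcases abs_choice l with h | h
  · rw [h, lorentzPm]; simp
  · have e : ((-l : ℤ) : ℂ) / 2 + (l : ℂ) / 2 = 0 := by push_cast; ring
    rw [h, lorentzPm, e]; simp

theorem isReduced_lorentz (l : ℤ) (rho : ℂ) :
    SpinSpace.IsReduced (lorentzSpins l rho) (lorentzP ((l : ℂ) / 2) rho)
      (lorentzPm ((l : ℂ) / 2) rho) where
  boundary n h := by
    by_cases hn : n ∈ lorentzSpins l rho
    · obtain ⟨k, rfl, hk⟩ := hn
      by_contra h0
      refine h ⟨fun _ => ⟨k + 1, by push_cast; ring, fun i hi => ?_⟩, fun _ => ⟨k, rfl, hk⟩⟩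
      rcases Nat.lt_succ_iff_lt_or_eq.mp hi with hi | rfl
      · exact hk i hi
      · convert h0 using 2
        push_cast; ring
    · have h2 : n + 2 ∈ lorentzSpins l rho := by tauto
      obtain ⟨k, hk, hk'⟩ := h2
      rcases k with _ | k
      · rw [← lorentzPm_abs l rho]
        congr 1
        have : (n : ℂ) + 2 = ((|l| : ℤ) : ℂ) := by exact_mod_cast by simpa using hk
        rw [← this]; ring
      · exact absurd ⟨k, by push_cast at hk; omega, fun i hi => hk' i (by omega)⟩ hn
  recur n hn _ := by
    obtain ⟨k, hk, -⟩ := hn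
    have h0 : 0 ≤ n := by have := abs_nonneg l; omega
    rw [lorentzP_eq, lorentzP_eq]
    have h1 : ((n : ℂ) / 2 + 1) ≠ 0 := by
      have : ((n + 2 : ℤ) : ℂ) ≠ 0 := by exact_mod_cast (by omega : n + 2 ≠ 0)
      intro h; apply this; push_cast; linear_combination 2 * h
    have h2 : ((n : ℂ) / 2 + 1 + 1) ≠ 0 := by
      have : ((n + 4 : ℤ) : ℂ) ≠ 0 := by exact_mod_cast (by omega : n + 4 ≠ 0)
      intro h; apply this; push_cast; linear_combination 2 * h
    rcases eq_or_ne n 0 with rfl | hn0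
    · have : l = 0 := by
        have := abs_nonneg l
        exact abs_eq_zero.mp (by omega)
      simp [this]
    · have h3 : (n : ℂ) ≠ 0 := by exact_mod_cast hn0
      have e : (n : ℂ) / 2 + 2 = (n : ℂ) / 2 + 1 + 1 := by ring
      have h4 : (n : ℂ) + 2 ≠ 0 := fun h => h1 (by linear_combination h / 2)
      have h5 : (n : ℂ) + 4 ≠ 0 := fun h => h2 (by linear_combination h / 2)
      have e1 : (n : ℂ) / 2 + 1 = (n + 2) / 2 := by ring
      have e2 : ((n : ℂ) + 2) / 2 + 1 = (n + 4) / 2 := by ring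
      rw [e, e1, e2]
      field_simp
  norm n hn hn0 := by
    obtain ⟨k, hk, -⟩ := hn
    have h0 : 0 ≤ n := by have := abs_nonneg l; omega
    have h3 : (n : ℂ) ≠ 0 := by exact_mod_cast hn0
    have h1 : ((n : ℂ) + 1) ≠ 0 := by exact_mod_cast (by omega : n + 1 ≠ 0)
    have h2 : ((n : ℂ) + 2) ≠ 0 := by exact_mod_cast (by omega : n + 2 ≠ 0)
    have h4 : ((n : ℂ) + 3) ≠ 0 := by exact_mod_cast (by omega : n + 3 ≠ 0)
    rw [lorentzP_eq, lorentzPm_sq, lorentzPm_sq]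
    have x1 : -((n : ℂ) + 3) * (((((n : ℂ) / 2 + 1) ^ 2 - ((l : ℂ) / 2) ^ 2)
        * (((n : ℂ) / 2 + 1) ^ 2 - rho ^ 2)) / (((n : ℂ) / 2 + 1) ^ 2
          * ((2 * ((n : ℂ) / 2 + 1) + 1) * (2 * ((n : ℂ) / 2 + 1) - 1))))
        = -(((n + 2) ^ 2 - (l : ℂ) ^ 2) * ((n + 2) ^ 2 - 4 * rho ^ 2))
            / (4 * (n + 2) ^ 2 * (n + 1)) := by
      have a1 : (2 * ((n : ℂ) / 2 + 1) + 1) = n + 3 := by ring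
      have a2 : (2 * ((n : ℂ) / 2 + 1) - 1) = n + 1 := by ring
      have a3 : ((n : ℂ) / 2 + 1) = (n + 2) / 2 := by ring
      rw [a1, a2, a3]
      field_simp
      ring
    have x2 : ((n : ℂ) - 1) * (((((n : ℂ) / 2) ^ 2 - ((l : ℂ) / 2) ^ 2)
        * (((n : ℂ) / 2) ^ 2 - rho ^ 2)) / (((n : ℂ) / 2) ^ 2
          * ((2 * ((n : ℂ) / 2) + 1) * (2 * ((n : ℂ) / 2) - 1))))
        = ((n ^ 2 - (l : ℂ) ^ 2) * (n ^ 2 - 4 * rho ^ 2)) / (4 * n ^ 2 * (n + 1)) := by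
      have a1 : (2 * ((n : ℂ) / 2) + 1) = n + 1 := by ring
      have a2 : (2 * ((n : ℂ) / 2) - 1) = n - 1 := by ring
      rw [a1, a2]
      rcases eq_or_ne n 1 with rfl | hn1
      · have hl : l ^ 2 = 1 := by
          rw [← sq_abs]
          have := abs_nonneg l
          have h5 : |l| = 1 := by omega
          rw [h5]; rfl
        have hl' : (l : ℂ) ^ 2 = 1 := by exact_mod_cast hl
        simp [hl']
      · have h6 : ((n : ℂ) - 1) ≠ 0 := by
          have : ((n - 1 : ℤ) : ℂ) ≠ 0 := by exact_mod_cast (by omega : n - 1 ≠ 0)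
          simpa using this
        field_simp
        ring
    rw [x1, x2]
    have x3 : ((n : ℂ) / 2 + 1) = (n + 2) / 2 := by ring
    rw [x3, div_pow, mul_pow, mul_pow, Complex.I_sq]
    field_simp
    ring

/-- The irreducible module `V_{λ,ρ}`, `λ = l / 2`: the algebraic direct sum of the spin-`j`
representations, `j ∈ {|λ|, |λ| + 1, …, j_max}` (`j_max` possibly infinite), on which the boosts
have reduced matrix elements `P^±_{λ,ρ}(j)` and `P_{λ,ρ}(j)`. -/
def LorentzModule (l : ℤ) (rho : ℂ) : Type := SpinSpace (lorentzSpins l rho)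

namespace LorentzModule

variable (l : ℤ) (rho : ℂ)

instance : AddCommGroup (LorentzModule l rho) :=
  inferInstanceAs (AddCommGroup (SpinSpace (lorentzSpins l rho)))
instance : Module ℂ (LorentzModule l rho) :=
  inferInstanceAs (Module ℂ (SpinSpace (lorentzSpins l rho)))
instance : LieRingModule LorentzAlgebra (LorentzModule l rho) :=
  (SpinSpace.generators (isReduced_lorentz l rho)).lieRingModule
instance : LieModule ℂ LorentzAlgebra (LorentzModule l rho) :=
  (SpinSpace.generators (isReduced_lorentz l rho)).lieModule

/-- The basis `|(λ,ρ) j, m⟩`. It is orthonormal for the inner product of `V_{λ,ρ}`, so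
`⟨(λ,ρ) j, m | v⟩` is the coordinate of `v` along `|(λ,ρ) j, m⟩`. -/
def basis : Module.Basis (SpinIndex (lorentzSpins l rho)) ℂ (LorentzModule l rho) :=
  (Finsupp.basisSingleOne :
    Module.Basis (SpinIndex (lorentzSpins l rho)) ℂ (SpinSpace (lorentzSpins l rho)))

end LorentzModule

/-! ### Tensor operators and Clebsch–Gordan decompositions -/

/-- Labels `μ₁, μ₂, (j, m)` of the basis of `(γ₁, γ₂) ⊗ V_{λ,ρ}`. -/
abbrev ProductIndex (g₁ g₂ : ℕ) (l : ℤ) (rho : ℂ) : Type :=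
  SpinIndex {(g₁ : ℤ)} × SpinIndex {(g₂ : ℤ)} × SpinIndex (lorentzSpins l rho)

/-- The module `(γ₁, γ₂) ⊗ V_{λ,ρ}`. -/
abbrev ProductModule (g₁ g₂ : ℕ) (l : ℤ) (rho : ℂ) : Type :=
  FiniteLorentzModule g₁ g₂ ⊗[ℂ] LorentzModule l rho

/-- The vector `|(γ₁,γ₂) μ₁, μ₂; (λ,ρ) j, m⟩` of `(γ₁, γ₂) ⊗ V_{λ,ρ}`. -/
def productKet {g₁ g₂ : ℕ} {l : ℤ} {rho : ℂ} (x : ProductIndex g₁ g₂ l rho) :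
    ProductModule g₁ g₂ l rho :=
  (ChiralModule.basis (-1) g₁ x.1 ⊗ₜ[ℂ] ChiralModule.basis 1 g₂ x.2.1) ⊗ₜ[ℂ]
    LorentzModule.basis l rho x.2.2

/-- A tensor operator `T : (γ₁, γ₂) ⊗ V_{λ,ρ} → V_{λ',ρ'}`: a linear map commuting with the action
of every element of the Lie algebra. Since the maximal compact subgroup `SU(2)` of `Spin(3,1)` is
connected, such a map also commutes with `SU(2)`. -/
abbrev TensorOperator (g₁ g₂ : ℕ) (l : ℤ) (rho : ℂ) (l' : ℤ) (rho' : ℂ) : Type :=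
  ProductModule g₁ g₂ l rho →ₗ⁅ℂ, LorentzAlgebra⁆ LorentzModule l' rho'

/-- The matrix element `⟨(λ',ρ') j', m' | T | (γ₁,γ₂) μ₁, μ₂; (λ,ρ) j, m⟩`. -/
def TensorOperator.matrixElement {g₁ g₂ : ℕ} {l : ℤ} {rho : ℂ} {l' : ℤ} {rho' : ℂ}
    (T : TensorOperator g₁ g₂ l rho l' rho') (y : SpinIndex (lorentzSpins l' rho'))
    (x : ProductIndex g₁ g₂ l rho) : ℂ :=
  (LorentzModule.basis l' rho').repr (T (productKet x)) y

/-- A decomposition of a module as a direct sum of irreducible submodules `W_i`. -/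
structure ClebschGordanDecomposition (M : Type*) [AddCommGroup M] [Module ℂ M]
    [LieRingModule LorentzAlgebra M] [LieModule ℂ LorentzAlgebra M] (ι : Type*)
    [DecidableEq ι] where
  W : ι → LieSubmodule ℂ LorentzAlgebra M
  irreducible : ∀ i, LieModule.IsIrreducible ℂ LorentzAlgebra (W i)
  isInternal : DirectSum.IsInternal fun i => (W i).toSubmodule

namespace ClebschGordanDecomposition

variable {M : Type*} [AddCommGroup M] [Module ℂ M] [LieRingModule LorentzAlgebra M]
  [LieModule ℂ LorentzAlgebra M] {ι : Type*} [DecidableEq ι]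

/-- The component in `W_i` of a vector. -/
def component (D : ClebschGordanDecomposition M ι) (i : ι) (v : M) : D.W i :=
  (LinearEquiv.ofBijective (DirectSum.coeLinearMap fun i => (D.W i).toSubmodule)
    D.isInternal).symm v i

/-- The indices of the components isomorphic to `V_{λ,ρ}`; they count its multiplicity. -/
def Occurrences (D : ClebschGordanDecomposition M ι) (l : ℤ) (rho : ℂ) : Type _ :=
  {i : ι // Nonempty (LorentzModule l rho ≃ₗ⁅ℂ, LorentzAlgebra⁆ D.W i)}

/-- A choice, in every component `W_α` isomorphic to `V_{λ,ρ}`, of basis vectors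
`|[α] (λ,ρ) j, m⟩` on which the generators act as on the standard basis `|(λ,ρ) j, m⟩`: the images
of the standard basis vectors under an isomorphism. -/
abbrev Frame (D : ClebschGordanDecomposition M ι) (l : ℤ) (rho : ℂ) : Type _ :=
  (α : D.Occurrences l rho) → LorentzModule l rho ≃ₗ⁅ℂ, LorentzAlgebra⁆ D.W α.1

/-- The basis `|[α] (λ,ρ) j, m⟩` of the component `W_α`. -/
def frameBasis (D : ClebschGordanDecomposition M ι) {l : ℤ} {rho : ℂ} (φ : D.Frame l rho)
    (α : D.Occurrences l rho) :
    Module.Basis (SpinIndex (lorentzSpins l rho)) ℂ (D.W α.1) :=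
  (LorentzModule.basis l rho).map (φ α).toLinearEquiv

end ClebschGordanDecomposition

/-- The inverse Clebsch–Gordan coefficient
`B{[α] (λ',ρ') j', m' | (γ₁,γ₂) μ₁, μ₂; (λ,ρ) j, m}`: the coefficient of `|[α] (λ',ρ') j', m'⟩` in
the expansion of `|(γ₁,γ₂) μ₁, μ₂; (λ,ρ) j, m⟩` along the decomposition. -/
def inverseClebschGordan {g₁ g₂ : ℕ} {l : ℤ} {rho : ℂ} {ι : Type*} [DecidableEq ι]
    (D : ClebschGordanDecomposition (ProductModule g₁ g₂ l rho) ι) {l' : ℤ} {rho' : ℂ}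
    (φ : D.Frame l' rho') (α : D.Occurrences l' rho') (y : SpinIndex (lorentzSpins l' rho'))
    (x : ProductIndex g₁ g₂ l rho) : ℂ :=
  (D.frameBasis φ α).repr (D.component α.1 (productKet x)) y

end

/-! The theorem is Schur's lemma applied to each summand of the decomposition. Restricted to a
component `W_i`, a tensor operator is a homomorphism between irreducible modules. If `W_i` is not
isomorphic to `V_{λ',ρ'}`, the restriction is zero (`LieModuleHom.nonempty_equiv_of_ne_zero`). If
`W_α` is isomorphic to it, then `T ∘ φ_α` is an endomorphism of `V_{λ',ρ'}`, hence a scalar `N_α`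
(`LorentzModule.exists_eq_smul`). Summing over components gives `T = ∑ N_α φ_α⁻¹ ∘ pr_α`
(`exists_hom_eq_sum`), and the coordinates of `φ_α⁻¹ ∘ pr_α` on product vectors are by definition
the inverse Clebsch–Gordan coefficients.

Two inputs need the explicit model. Irreducibility of `V_{λ,ρ}` comes from `J_0` and `J_- J_+`,
which are diagonal and separate the vectors `|j, m⟩`: a submodule contains every basis vector
occurring in one of its elements. The ladder operators `J_±` then connect all `m` for fixed `j`, and
`K_0` connects neighbouring `j`, because `P^+` does not vanish before `j_max`. The same diagonal
operators give Schur's lemma in infinite dimension, where an eigenvalue cannot be taken from a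
characteristic polynomial: an endomorphism commuting with them has every `|j, m⟩` as an eigenvector.

Finiteness of the decomposition holds because, for any `v ≠ 0` in `V_{λ,ρ}`, the finite-dimensional
space `(γ₁, γ₂) ⊗ v` generates the whole product (`LieSubmodule.eq_top_of_tmul_mem`). Its generators
involve only finitely many summands, and those must be all of them (`finite_index`). -/

open scoped TensorProduct

noncomputable section

/-! ### Families of diagonal operators that separate the basis vectors -/

section Diagonal

variable {ι κ : Type*} {A : κ → Module.End ℂ (ι →₀ ℂ)} {a : κ → ι → ℂ}

theorem diagonal_apply (hA : ∀ k x, A k (Finsupp.single x 1) = a k x • Finsupp.single x 1)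
    (k : κ) (v : ι →₀ ℂ) (z : ι) : A k v z = a k z * v z := by
  classical
  induction v using Finsupp.induction_linear with
  | zero => simp
  | add f g hf hg => simp [hf, hg, mul_add]
  | single x c =>
    have h : Finsupp.single x c = c • Finsupp.single x (1 : ℂ) := by simp
    rw [h, map_smul, hA]
    by_cases hx : x = z
    · subst hx; simp [mul_comm]
    · simp [hx]

/-- A subspace stable under a separating family of diagonal operators contains every basis vector
that occurs in one of its elements. -/
theorem single_mem_of_diagonal
    (hA : ∀ k x, A k (Finsupp.single x 1) = a k x • Finsupp.single x 1)
    (hsep : ∀ x y, x ≠ y → ∃ k, a k x ≠ a k y)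
    (N : Submodule ℂ (ι →₀ ℂ)) (hN : ∀ k, ∀ v ∈ N, A k v ∈ N) {v : ι →₀ ℂ} (hv : v ∈ N) {x : ι}
    (hx : v x ≠ 0) : Finsupp.single x 1 ∈ N := by
  classical
  induction hn : v.support.card using Nat.strong_induction_on generalizing v with
  | _ n ih =>
    by_cases h : ∃ y ∈ v.support, y ≠ x
    · obtain ⟨y, hy, hyx⟩ := h
      obtain ⟨k, hk⟩ := hsep x y hyx.symm
      -- Applying `A k - a k y` kills the coordinate at `y` and keeps the one at `x` nonzero, so the
      -- support shrinks without losing `x`.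
      have hw : ∀ z, (A k v - a k y • v) z = (a k z - a k y) * v z := fun z => by
        simp [diagonal_apply hA, sub_mul]
      refine ih _ ?_ (N.sub_mem (hN k v hv) (N.smul_mem (a k y) hv)) ?_ rfl
      · rw [← hn]
        refine Finset.card_lt_card ⟨fun z hz => ?_, fun hs => ?_⟩
        · rw [Finsupp.mem_support_iff, hw] at hz
          exact Finsupp.mem_support_iff.mpr (right_ne_zero_of_mul hz)
        · have := hs hy
          rw [Finsupp.mem_support_iff, hw] at this
          simp at this
      · rw [hw]
        exact mul_ne_zero (sub_ne_zero.mpr hk) hx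
    · push Not at h
      have hvx : (v x)⁻¹ • v = Finsupp.single x 1 := by
        ext z
        by_cases hz : z = x
        · subst hz; simp [hx]
        · have : v z = 0 := by
            by_contra h0
            exact hz (h z (Finsupp.mem_support_iff.mpr h0))
          simp [this, Ne.symm hz]
      exact hvx ▸ N.smul_mem _ hv

/-- An operator commuting with a separating family of diagonal operators is diagonal. -/
theorem map_single_of_commute_diagonal
    (hA : ∀ k x, A k (Finsupp.single x 1) = a k x • Finsupp.single x 1)
    (hsep : ∀ x y, x ≠ y → ∃ k, a k x ≠ a k y) (f : Module.End ℂ (ι →₀ ℂ))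
    (hf : ∀ k v, f (A k v) = A k (f v)) (x : ι) :
    f (Finsupp.single x 1) = f (Finsupp.single x 1) x • Finsupp.single x 1 := by
  classical
  ext z
  by_cases hz : x = z
  · subst hz; simp
  · obtain ⟨k, hk⟩ := hsep x z hz
    -- Comparing coordinates at `z` makes the off-diagonal entry a solution of `(a k x - a k z) * _
    -- = 0`.
    have h := congrArg (fun w => w z) (hf k (Finsupp.single x 1))
    simp only [hA, map_smul, diagonal_apply hA, Finsupp.smul_apply, smul_eq_mul] at h
    have h0 : (a k x - a k z) * f (Finsupp.single x 1) z = 0 := by linear_combination h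
    rw [(mul_eq_zero.mp h0).resolve_left (sub_ne_zero.mpr hk)]
    simp [hz]

end Diagonal

/-! ### Weight vectors of the rotation algebra and an irreducibility criterion -/

namespace SpinSpace

variable {S : Set ℤ}

/-- The label `(p, q) = (j + m, j - m)`. -/
def index (p q : ℤ) (h : 0 ≤ p ∧ 0 ≤ q ∧ p + q ∈ S) : SpinIndex S := ⟨(p, q), h⟩

theorem index_fst (p q : ℤ) (h : 0 ≤ p ∧ 0 ≤ q ∧ p + q ∈ S) : (index p q h).1.1 = p := rfl

theorem index_snd (p q : ℤ) (h : 0 ≤ p ∧ 0 ≤ q ∧ p + q ∈ S) : (index p q h).1.2 = q := rfl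

theorem csqrt_ne_zero {z : ℂ} (hz : z ≠ 0) : Complex.sqrt z ≠ 0 := fun h => hz (by
  rw [← csqrt_sq z, h]; simp)

theorem csqrt_intCast_ne_zero {n : ℤ} (hn : 0 < n) : Complex.sqrt n ≠ 0 :=
  csqrt_ne_zero (by exact_mod_cast hn.ne')

theorem csqrt_intCast_add_one_ne_zero {n : ℤ} (hn : 0 ≤ n) : Complex.sqrt (n + 1) ≠ 0 :=
  csqrt_ne_zero (by exact_mod_cast (by omega : n + 1 ≠ 0))

/-- The commuting diagonal operators `J_0` and `J_- J_+`. -/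
def rotationDiagonal (S : Set ℤ) : Bool → Module.End ℂ (SpinSpace S)
  | true => J0 S
  | false => Jm S * Jp S

/-- The eigenvalues of `J_0` and `J_- J_+`. -/
def rotationEigenvalue : Bool → SpinIndex S → ℂ
  | true, x => ((x.1.1 : ℂ) - x.1.2) / 2
  | false, x => x.1.2 * (x.1.1 + 1)

theorem rotationDiagonal_single (k : Bool) (x : SpinIndex S) :
    rotationDiagonal S k (Finsupp.single x 1) = rotationEigenvalue k x • Finsupp.single x 1 := by
  rw [← ket_index]
  cases k
  -- The coefficient of `J_-` at `(p + 1, q - 1)` equals that of `J_+` at `(p, q)`, so the square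
  -- roots pair up to `q (p + 1)`.
  · simp only [rotationDiagonal, rotationEigenvalue, Module.End.mul_apply, Jp_ket, map_smul, Jm_ket,
      smul_smul]
    push_cast
    rw [add_sub_cancel_right, sub_add_cancel, sub_add_cancel]
    congr 1
    linear_combination Complex.sqrt (x.1.1 + 1) ^ 2 * csqrt_sq x.1.2
      + x.1.2 * csqrt_sq (x.1.1 + 1)
  · exact J0_ket _ _

/-- The eigenvalues are `m` and `(j - m)(j + m + 1) = j(j + 1) - m(m + 1)`; together they determine
`j(j + 1)`, hence `j ≥ 0`. -/
theorem rotationEigenvalue_separates (x y : SpinIndex S) (h : x ≠ y) :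
    ∃ k, rotationEigenvalue k x ≠ rotationEigenvalue k y := by
  by_contra hk
  push Not at hk
  obtain ⟨⟨p, q⟩, hp, hq, hx⟩ := x
  obtain ⟨⟨p', q'⟩, hp', hq', hy⟩ := y
  have h1 : p - q = p' - q' := by
    have : (p : ℂ) - q = p' - q' := by
      have := hk true
      simp only [rotationEigenvalue] at this
      linear_combination 2 * this
    exact_mod_cast this
  have h2 : q * (p + 1) = q' * (p' + 1) := by
    have := hk false
    simp only [rotationEigenvalue] at this
    exact_mod_cast this
  simp only at hp hq hp' hq'
  -- With `p - q` fixed, the difference of the two products factors, and the second factor is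
  -- positive since `q, p' ≥ 0`.
  have h3 : (q - q') * (q + p' + 1) = 0 := by
    linear_combination h2 - q * h1
  have h4 : q = q' := by
    rcases mul_eq_zero.mp h3 with h | h <;> omega
  have h5 : p = p' := by omega
  subst h4 h5
  exact h rfl

/-- The tool for isolating one term of `K_0 |j, m⟩`: a nonzero matrix element is enough to put the
target vector into the subspace. -/
theorem ket_mem_of_apply_ne_zero {N : Submodule ℂ (SpinSpace S)} (h0 : ∀ v ∈ N, J0 S v ∈ N)
    (hp : ∀ v ∈ N, Jp S v ∈ N) (hm : ∀ v ∈ N, Jm S v ∈ N) {v : SpinSpace S} (hv : v ∈ N)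
    {x : SpinIndex S} (hx : v x ≠ 0) : ket S x.1.1 x.1.2 ∈ N := by
  rw [ket_index]
  refine single_mem_of_diagonal rotationDiagonal_single rotationEigenvalue_separates N ?_ hv hx
  rintro (_ | _) w hw
  · exact hm _ (hp _ hw)
  · exact h0 _ hw

theorem ket_apply (p q : ℤ) (x : SpinIndex S) :
    ket S p q x = if p = x.1.1 ∧ q = x.1.2 then 1 else 0 := by
  classical
  by_cases h : 0 ≤ p ∧ 0 ≤ q ∧ p + q ∈ S
  · have e : index p q h = x ↔ p = x.1.1 ∧ q = x.1.2 := Subtype.ext_iff.trans Prod.ext_iff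
    have e' : ket S p q = Finsupp.single (index p q h) 1 := ket_index (index p q h)
    rw [e', Finsupp.single_apply]
    simp only [e]
  · rw [ket_of_not h, if_neg]
    · rfl
    · rintro ⟨rfl, rfl⟩
      exact h x.2

variable {P Pm : ℂ → ℂ}

/-- Written with indicators so that `simp` can discard the two irrelevant terms once `x` is
concrete. -/
theorem K0_ket_apply (hP : IsReduced S P Pm) (p q : ℤ) (x : SpinIndex S) :
    K0 S P Pm (ket S p q) x =
      Pm ((p + q : ℂ) / 2 + 1) * (Complex.sqrt (p + 1) * Complex.sqrt (q + 1))
          * (if p + 1 = x.1.1 ∧ q + 1 = x.1.2 then 1 else 0)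
        + P ((p + q : ℂ) / 2) * (((p : ℂ) - q) / 2) * (if p = x.1.1 ∧ q = x.1.2 then 1 else 0)
        + Pm ((p + q : ℂ) / 2) * (Complex.sqrt p * Complex.sqrt q)
          * (if p - 1 = x.1.1 ∧ q - 1 = x.1.2 then 1 else 0) := by
  rw [K0_ket hP, ← ket_apply, ← ket_apply, ← ket_apply]
  rfl

/-- A nonzero subspace stable under the generators is everything, if the spins form a chain along
which the reduced matrix elements do not vanish. -/
theorem eq_top_of_stable {n₀ : ℤ} (hP : IsReduced S P Pm) (hS : ∀ n ∈ S, ∃ k : ℕ, n = n₀ + 2 * k)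
    (hn₀ : 0 ≤ n₀)
    (hdown : ∀ n, n₀ ≤ n → n + 2 ∈ S → n ∈ S ∧ Pm ((n : ℂ) / 2 + 1) ≠ 0)
    {N : Submodule ℂ (SpinSpace S)} (h0 : ∀ v ∈ N, J0 S v ∈ N)
    (hp : ∀ v ∈ N, Jp S v ∈ N) (hm : ∀ v ∈ N, Jm S v ∈ N) (hK : ∀ v ∈ N, K0 S P Pm v ∈ N)
    (hN : N ≠ ⊥) : N = ⊤ := by
  -- Inside one spin `p + q` is constant and the ladder coefficients vanish only at the ends, so any
  -- weight vector reaches any other through the highest one, `q = 0`. Stability under `K_±` need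
  -- not be assumed: up to sign these are the commutators of `J_±` with `K_0`.
  have raise : ∀ p q : ℤ, 0 ≤ p → 0 ≤ q → ket S p (q + 1) ∈ N → ket S (p + 1) q ∈ N := by
    intro p q h1 h2 h
    have := hp _ h
    rw [Jp_ket, add_sub_cancel_right] at this
    refine (N.smul_mem_iff (mul_ne_zero ?_ ?_)).mp this
    · exact csqrt_intCast_ne_zero (by omega)
    · exact csqrt_intCast_add_one_ne_zero h1
  have lower : ∀ p q : ℤ, 0 ≤ p → 0 ≤ q → ket S (p + 1) q ∈ N → ket S p (q + 1) ∈ N := by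
    intro p q h1 h2 h
    have := hm _ h
    rw [Jm_ket, add_sub_cancel_right] at this
    refine (N.smul_mem_iff (mul_ne_zero ?_ ?_)).mp this
    · exact csqrt_intCast_ne_zero (by omega)
    · exact csqrt_intCast_add_one_ne_zero h2
  have top : ∀ k : ℕ, ∀ p : ℤ, 0 ≤ p → ket S p k ∈ N → ket S (p + k) 0 ∈ N := by
    intro k
    induction k with
    | zero => intro p _ h; simpa using h
    | succ k ih =>
      intro p h1 h
      have := ih (p + 1) (by omega) (raise p k h1 (by omega) (by exact_mod_cast h))
      rwa [show p + ((k + 1 : ℕ) : ℤ) = p + 1 + k by push_cast; ring]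
  have all : ∀ k : ℕ, ∀ p : ℤ, 0 ≤ p → ket S (p + k) 0 ∈ N → ket S p k ∈ N := by
    intro k
    induction k with
    | zero => intro p _ h; simpa using h
    | succ k ih =>
      intro p h1 h
      rw [show p + ((k + 1 : ℕ) : ℤ) = p + 1 + k by push_cast; ring] at h
      exact_mod_cast lower p k h1 (by omega) (ih (p + 1) (by omega) h)
  have move : ∀ p q p' q' : ℤ, 0 ≤ p → 0 ≤ q → 0 ≤ p' → 0 ≤ q' → p + q = p' + q' →
      ket S p q ∈ N → ket S p' q' ∈ N := by
    intro p q p' q' h1 h2 h3 h4 h5 h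
    lift q to ℕ using h2
    lift q' to ℕ using h4
    refine all _ _ h3 ?_
    rw [← h5]
    exact top _ _ h1 h
  -- `n` stands for `2 j`, so the next spin is `n + 2`. The component of `K_0 |j, j⟩` on `|j + 1,
  -- j⟩`, i.e. on `(n + 1, 1)`, is nonzero because `P^+(j) ≠ 0`.
  have step_up : ∀ n, n ∈ S → n + 2 ∈ S → ket S n 0 ∈ N → ket S (n + 2) 0 ∈ N := by
    intro n hn hn2 h
    obtain ⟨k, hk⟩ := hS n hn
    obtain ⟨-, hne⟩ := hdown n (by omega) hn2
    have hi : 0 ≤ n + 1 ∧ (0 : ℤ) ≤ 1 ∧ n + 1 + 1 ∈ S :=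
      ⟨by omega, zero_le_one, by rwa [add_assoc]⟩
    have hx : K0 S P Pm (ket S n 0) (index (n + 1) 1 hi) ≠ 0 := by
      have e1 : ¬ (n = n + 1) := by omega
      have e2 : ¬ (n - 1 = n + 1) := by omega
      simp only [K0_ket_apply hP, index_fst, index_snd, e1, e2, false_and, if_false,
        mul_zero, add_zero, zero_add, and_self, if_true, mul_one, Int.cast_zero]
      exact mul_ne_zero hne (mul_ne_zero (csqrt_intCast_add_one_ne_zero (by omega))
        (csqrt_ne_zero one_ne_zero))
    have := ket_mem_of_apply_ne_zero h0 hp hm (hK _ h) hx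
    exact move (n + 1) 1 _ _ (by omega) zero_le_one (by omega) le_rfl (by ring) this
  have step_down : ∀ n, n₀ ≤ n → n + 2 ∈ S → ket S (n + 2) 0 ∈ N → ket S n 0 ∈ N := by
    intro n hn hn2 h
    obtain ⟨hnS, hne⟩ := hdown n hn hn2
    -- The downward coefficient of `K_0` contains `√(j - m)` and vanishes on a highest weight
    -- vector, so one first passes to `q = 1`.
    have h' := move (n + 2) 0 (n + 1) 1 (by omega) le_rfl (by omega) (by omega) (by ring) h
    have hi : 0 ≤ n ∧ (0 : ℤ) ≤ 0 ∧ n + 0 ∈ S := ⟨by omega, le_rfl, by rwa [add_zero]⟩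
    have hx : K0 S P Pm (ket S (n + 1) 1) (index n 0 hi) ≠ 0 := by
      have e1 : ¬ (n + 1 + 1 = n) := by omega
      have e2 : ¬ (n + 1 = n) := by omega
      have e3 : (((n + 1 : ℤ) : ℂ) + ((1 : ℤ) : ℂ)) / 2 = (n : ℂ) / 2 + 1 := by push_cast; ring
      simp only [K0_ket_apply hP, index_fst, index_snd, e1, e2, false_and, if_false, mul_zero, zero_add,
        add_sub_cancel_right, sub_self, and_self, if_true, mul_one, e3]
      exact mul_ne_zero hne (mul_ne_zero (csqrt_intCast_ne_zero (by omega))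
        (csqrt_intCast_ne_zero one_pos))
    exact ket_mem_of_apply_ne_zero h0 hp hm (hK _ h') hx
  have descend : ∀ k : ℕ, n₀ + 2 * k ∈ S → ket S (n₀ + 2 * k) 0 ∈ N → ket S n₀ 0 ∈ N := by
    intro k
    induction k with
    | zero => intro _ h; simpa using h
    | succ k ih =>
      intro hk h
      have e : n₀ + 2 * ((k + 1 : ℕ) : ℤ) = n₀ + 2 * k + 2 := by push_cast; ring
      rw [e] at hk h
      exact ih (hdown _ (by omega) hk).1 (step_down _ (by omega) hk h)
  have ascend : ∀ k : ℕ, n₀ + 2 * k ∈ S → ket S n₀ 0 ∈ N → ket S (n₀ + 2 * k) 0 ∈ N := by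
    intro k
    induction k with
    | zero => intro _ h; simpa using h
    | succ k ih =>
      intro hk h
      have e : n₀ + 2 * ((k + 1 : ℕ) : ℤ) = n₀ + 2 * k + 2 := by push_cast; ring
      rw [e] at hk ⊢
      have hk' := (hdown _ (by omega) hk).1
      exact step_up _ hk' hk (ih hk' h)
  obtain ⟨v, hv, hv0⟩ := N.exists_mem_ne_zero_of_ne_bot hN
  obtain ⟨x, hx⟩ : ∃ x, v x ≠ 0 := by
    by_contra h
    push Not at h
    exact hv0 (Finsupp.ext h)
  have hx' := ket_mem_of_apply_ne_zero h0 hp hm hv hx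
  -- From any occurring vector one goes down to the highest weight vector of the lowest spin; every
  -- basis vector is then reached from there by going up.
  have hbase : ket S n₀ 0 ∈ N := by
    obtain ⟨⟨p, q⟩, h1, h2, h3⟩ := x
    obtain ⟨k, hk⟩ := hS _ h3
    simp only at h1 h2 h3 hk hx'
    refine descend k (hk ▸ h3) (move _ _ _ _ h1 h2 (by omega) le_rfl (by omega) hx')
  rw [eq_top_iff]
  rintro w -
  rw [← Finsupp.sum_single w]
  refine N.sum_mem fun x _ => ?_
  rw [← mul_one (w x), ← smul_eq_mul, ← Finsupp.smul_single]
  refine N.smul_mem _ ?_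
  rw [← ket_index]
  obtain ⟨⟨p, q⟩, h1, h2, h3⟩ := x
  obtain ⟨k, hk⟩ := hS _ h3
  simp only at h1 h2 h3 hk ⊢
  exact move (n₀ + 2 * k) 0 _ _ (by omega) le_rfl h1 h2 (by omega) (ascend k (hk ▸ h3) hbase)

end SpinSpace

/-! ### Lie algebra elements realising the individual generators -/

namespace LorentzAlgebra.Generators

variable {E : Type*} [AddCommGroup E] [Module ℂ E] (G : Generators E)

/-- The element of the Lie algebra that acts as `J0`. -/
def elemJ0 : LorentzAlgebra :=
  ((![1, 0, 0], 0) : (Fin 3 → ℂ) × (Fin 3 → ℂ))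

theorem op_elemJ0 : G.op elemJ0 = G.J0 := by
  have h1 : elemJ0.1 = ![1, 0, 0] := rfl
  have h2 : elemJ0.2 = 0 := rfl
  rw [op_eq, h1, h2]
  simp only [Matrix.cons_val, Pi.zero_apply]
  norm_num

/-- The element of the Lie algebra that acts as `Jp`. -/
def elemJp : LorentzAlgebra :=
  ((![0, 1, Complex.I], 0) : (Fin 3 → ℂ) × (Fin 3 → ℂ))

theorem op_elemJp : G.op elemJp = G.Jp := by
  have h1 : elemJp.1 = ![0, 1, Complex.I] := rfl
  have h2 : elemJp.2 = 0 := rfl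
  rw [op_eq, h1, h2]
  simp only [Matrix.cons_val, Pi.zero_apply]
  norm_num

/-- The element of the Lie algebra that acts as `Jm`. -/
def elemJm : LorentzAlgebra :=
  ((![0, 1, -Complex.I], 0) : (Fin 3 → ℂ) × (Fin 3 → ℂ))

theorem op_elemJm : G.op elemJm = G.Jm := by
  have h1 : elemJm.1 = ![0, 1, -Complex.I] := rfl
  have h2 : elemJm.2 = 0 := rfl
  rw [op_eq, h1, h2]
  simp only [Matrix.cons_val, Pi.zero_apply]
  norm_num

/-- The element of the Lie algebra that acts as `K0`. -/
def elemK0 : LorentzAlgebra :=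
  ((0, ![1, 0, 0]) : (Fin 3 → ℂ) × (Fin 3 → ℂ))

theorem op_elemK0 : G.op elemK0 = G.K0 := by
  have h1 : elemK0.1 = 0 := rfl
  have h2 : elemK0.2 = ![1, 0, 0] := rfl
  rw [op_eq, h1, h2]
  simp only [Matrix.cons_val, Pi.zero_apply]
  norm_num

end LorentzAlgebra.Generators

/-! ### Irreducibility of `V_{λ,ρ}` and its endomorphisms -/

namespace LorentzModule

open LorentzAlgebra SpinSpace

variable (l : ℤ) (rho : ℂ)

theorem abs_mem_lorentzSpins : |l| ∈ lorentzSpins l rho := ⟨0, by simp, by simp⟩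

instance : Nontrivial (LorentzModule l rho) :=
  haveI : Nonempty (SpinIndex (lorentzSpins l rho)) :=
    ⟨⟨(|l|, 0), abs_nonneg l, le_rfl, by simpa using abs_mem_lorentzSpins l rho⟩⟩
  inferInstanceAs (Nontrivial (SpinIndex (lorentzSpins l rho) →₀ ℂ))

/-- The spins are cut off at the first zero of `P^+`, so consecutive spins that both occur are
always linked by a nonzero reduced matrix element, which is what `eq_top_of_stable` needs. -/
instance isIrreducible : LieModule.IsIrreducible ℂ LorentzAlgebra (LorentzModule l rho) := by
  refine LieModule.IsIrreducible.mk fun N hN => ?_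
  have hred := isReduced_lorentz l rho
  rw [← LieSubmodule.toSubmodule_eq_top]
  refine eq_top_of_stable (N := N.toSubmodule) (n₀ := |l|) hred ?_ (abs_nonneg l) ?_ ?_ ?_ ?_ ?_ ?_
  · rintro n ⟨k, hk, -⟩
    exact ⟨k, hk⟩
  · rintro n hn ⟨k, hk, hk'⟩
    -- For `k = 0` the spin label `n + 2` would be the lowest one, `|l|`, contradicting `n ≥ |l|`.
    rcases k with _ | k
    · simp at hk
      omega
    · have e : n = |l| + 2 * k := by push_cast at hk; omega
      refine ⟨⟨k, e, fun i hi => hk' i (by omega)⟩, ?_⟩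
      convert hk' k (by omega) using 2
      rw [e]
      push_cast
      ring
  · intro v hv
    exact (LinearMap.congr_fun (generators hred).op_elemJ0 v) ▸ N.lie_mem (x := Generators.elemJ0) hv
  · intro v hv
    exact (LinearMap.congr_fun (generators hred).op_elemJp v) ▸ N.lie_mem (x := Generators.elemJp) hv
  · intro v hv
    exact (LinearMap.congr_fun (generators hred).op_elemJm v) ▸ N.lie_mem (x := Generators.elemJm) hv
  · intro v hv
    exact (LinearMap.congr_fun (generators hred).op_elemK0 v) ▸ N.lie_mem (x := Generators.elemK0) hv
  · exact fun h => hN (N.toSubmodule_eq_bot.mp h)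

/-- Schur's lemma for `V_{λ,ρ}`. -/
theorem exists_eq_smul (f : LorentzModule l rho →ₗ⁅ℂ, LorentzAlgebra⁆ LorentzModule l rho) :
    ∃ c : ℂ, ∀ v, f v = c • v := by
  have hred := isReduced_lorentz l rho
  -- The vector `j = m = |λ|`, present for every `ρ`; any basis vector would serve.
  let x : SpinIndex (lorentzSpins l rho) :=
    ⟨(|l|, 0), abs_nonneg l, le_rfl, by simpa using abs_mem_lorentzSpins l rho⟩
  let g : Module.End ℂ (SpinSpace (lorentzSpins l rho)) := f.toLinearMap
  have hJ0 : ∀ v, g (J0 _ v) = J0 _ (g v) := fun v => by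
    have := f.map_lie Generators.elemJ0 v
    change f ((generators hred).op Generators.elemJ0 v) =
      (generators hred).op Generators.elemJ0 (f v) at this
    rwa [Generators.op_elemJ0] at this
  have hJp : ∀ v, g (Jp _ v) = Jp _ (g v) := fun v => by
    have := f.map_lie Generators.elemJp v
    change f ((generators hred).op Generators.elemJp v) =
      (generators hred).op Generators.elemJp (f v) at this
    rwa [Generators.op_elemJp] at this
  have hJm : ∀ v, g (Jm _ v) = Jm _ (g v) := fun v => by
    have := f.map_lie Generators.elemJm v
    change f ((generators hred).op Generators.elemJm v) =
      (generators hred).op Generators.elemJm (f v) at this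
    rwa [Generators.op_elemJm] at this
  have hx := map_single_of_commute_diagonal rotationDiagonal_single rotationEigenvalue_separates g
    (by
      rintro (_ | _) v
      · exact (hJm _).trans (congrArg _ (hJp v))
      · exact hJ0 v) x
  generalize g (Finsupp.single x 1) x = c at hx
  refine ⟨c, fun v => ?_⟩
  -- The eigenvector `x` lies in the kernel of `f - c`, a nonzero submodule, hence everything by
  -- irreducibility.
  let F : LorentzModule l rho →ₗ⁅ℂ, LorentzAlgebra⁆ LorentzModule l rho := f - c • LieModuleHom.id
  have hF : F.ker = ⊤ := by
    refine (eq_bot_or_eq_top F.ker).resolve_left fun hbot => ?_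
    have h1 : basis l rho x ∈ F.ker := by
      rw [LieModuleHom.mem_ker]
      exact sub_eq_zero.mpr hx
    rw [hbot, LieSubmodule.mem_bot] at h1
    exact (basis l rho).ne_zero x h1
  have hv : v ∈ F.ker := hF ▸ LieSubmodule.mem_top v
  exact sub_eq_zero.mp (LieModuleHom.mem_ker.mp hv)

end LorentzModule

/-! ### Homomorphisms between irreducible modules; generation of tensor products -/

section Schur

variable {L M N : Type*} [LieRing L] [AddCommGroup M] [Module ℂ M] [LieRingModule L M]
  [AddCommGroup N] [Module ℂ N] [LieRingModule L N]

/-- A nonzero homomorphism between irreducible modules is an isomorphism. -/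
theorem LieModuleHom.nonempty_equiv_of_ne_zero [LieModule.IsIrreducible ℂ L M]
    [LieModule.IsIrreducible ℂ L N] (f : M →ₗ⁅ℂ, L⁆ N) (hf : f ≠ 0) :
    Nonempty (M ≃ₗ⁅ℂ, L⁆ N) := by
  have hinj : Function.Injective f := by
    rw [← LieModuleHom.ker_eq_bot]
    by_contra h
    have := (eq_bot_or_eq_top f.ker).resolve_left h
    refine hf (LieModuleHom.ext fun v => ?_)
    exact LieModuleHom.mem_ker.mp (this ▸ LieSubmodule.mem_top v)
  have hsurj : Function.Surjective f := by
    rw [← LieModuleHom.range_eq_top]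
    refine (eq_bot_or_eq_top f.range).resolve_left fun h => ?_
    refine hf (LieModuleHom.ext fun v => ?_)
    have : f v ∈ f.range := (LieModuleHom.mem_range _ _).mpr ⟨v, rfl⟩
    rw [h, LieSubmodule.mem_bot] at this
    exact this
  obtain ⟨g, hg⟩ := Function.bijective_iff_has_inverse.mp ⟨hinj, hsurj⟩
  exact ⟨{ f with invFun := g, left_inv := hg.1, right_inv := hg.2 }⟩

open TensorProduct in
/-- If `v ≠ 0` lies in the irreducible module `N`, then `M ⊗ v` generates `M ⊗ N`. -/
theorem LieSubmodule.eq_top_of_tmul_mem [LieAlgebra ℂ L] [LieModule ℂ L M] [LieModule ℂ L N]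
    [LieModule.IsIrreducible ℂ L N] (U : LieSubmodule ℂ L (M ⊗[ℂ] N)) {v : N} (hv : v ≠ 0)
    (h : ∀ m : M, m ⊗ₜ[ℂ] v ∈ U) :
    U = ⊤ := by
  -- The set of `n` with `M ⊗ n ⊆ U` is a submodule by the Leibniz rule `m ⊗ X n = X (m ⊗ n) - (X m)
  -- ⊗ n`, whose right side lies in `U` because `m` ranges over all of `M`. It contains `v ≠ 0`, so
  -- it is all of `N`.
  let U' : LieSubmodule ℂ L N :=
    { carrier := {n | ∀ m : M, m ⊗ₜ[ℂ] n ∈ U}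
      add_mem' := fun ha hb m => by
        rw [TensorProduct.tmul_add]
        exact U.add_mem (ha m) (hb m)
      zero_mem' := fun m => by
        rw [TensorProduct.tmul_zero]
        exact U.zero_mem
      smul_mem' := fun c n hn m => by
        rw [TensorProduct.tmul_smul]
        exact U.smul_mem c (hn m)
      lie_mem := fun {X n} hn m => by
        have h1 := U.lie_mem (x := X) (hn m)
        rw [TensorProduct.LieModule.lie_tmul_right] at h1
        simpa using U.sub_mem h1 (hn ⁅X, m⁆) }
  have hU' : U' = ⊤ := by
    refine (eq_bot_or_eq_top U').resolve_left fun hbot => hv ?_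
    have : v ∈ U' := h
    rwa [hbot, LieSubmodule.mem_bot] at this
  rw [eq_top_iff]
  rintro w -
  induction w using TensorProduct.induction_on with
  | zero => exact U.zero_mem
  | add a b ha hb => exact U.add_mem ha hb
  | tmul m n =>
    have : n ∈ U' := hU' ▸ LieSubmodule.mem_top n
    exact this m

end Schur

/-! ### Finite dimension of the modules `F^A_γ` -/

theorem finite_spinIndex_singleton (g : ℕ) : Finite (SpinIndex {(g : ℤ)}) := by
  refine Finite.of_injective (β := Fin (g + 1)) (fun x => ⟨x.1.1.toNat, ?_⟩) ?_
  · obtain ⟨⟨p, q⟩, h1, h2, h3⟩ := x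
    simp only [Set.mem_singleton_iff] at h1 h2 h3 ⊢
    omega
  · rintro ⟨⟨p, q⟩, h1, h2, h3⟩ ⟨⟨p', q'⟩, h1', h2', h3'⟩ h
    simp only [Set.mem_singleton_iff, Fin.mk.injEq] at h1 h2 h3 h1' h2' h3' h
    have e1 : p = p' := by omega
    have e2 : q = q' := by omega
    subst e1 e2
    rfl

instance finiteDimensional_chiralModule (A : ℤˣ) (g : ℕ) :
    FiniteDimensional ℂ (ChiralModule A g) :=
  haveI := finite_spinIndex_singleton g
  Module.Finite.of_basis (ChiralModule.basis A g)

/-! ### Finiteness of decompositions and expansion of homomorphisms along them -/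

namespace ClebschGordanDecomposition

variable {M : Type*} [AddCommGroup M] [Module ℂ M] [LieRingModule LorentzAlgebra M]
  [LieModule ℂ LorentzAlgebra M] {ι : Type*} [DecidableEq ι]

/-- Apart from membership in `W_i`, this is the only property of `component` that the argument uses.
-/
theorem sum_component [Fintype ι] (D : ClebschGordanDecomposition M ι) (v : M) :
    ∑ i, (D.component i v : M) = v := by
  classical
  have h : DirectSum.coeLinearMap (fun i => (D.W i).toSubmodule)
      ((LinearEquiv.ofBijective (DirectSum.coeLinearMap fun i => (D.W i).toSubmodule)
        D.isInternal).symm v) = v :=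
    (LinearEquiv.ofBijective (DirectSum.coeLinearMap fun i => (D.W i).toSubmodule)
      D.isInternal).apply_symm_apply v
  rw [DirectSum.coeLinearMap_eq_dfinsuppSum,
    DFinsupp.sum_eq_sum_fintype _ (fun _ => rfl)] at h
  exact h

/-- A decomposition of a module that is generated by a finite-dimensional subspace is finite. -/
theorem finite_index (D : ClebschGordanDecomposition M ι) (F : Submodule ℂ M)
    [FiniteDimensional ℂ F] (hF : ∀ U : LieSubmodule ℂ LorentzAlgebra M,
      F ≤ U.toSubmodule → U = ⊤) : Finite ι := by
  classical
  obtain ⟨s, hs⟩ := (Submodule.fg_iff_finiteDimensional F).mpr inferInstance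
  have htop : (⨆ i, (D.W i).toSubmodule) = ⊤ := D.isInternal.submodule_iSup_eq_top
  have hmem : ∀ v : M, ∃ t : Finset ι, v ∈ ⨆ i ∈ t, D.W i := by
    intro v
    have hv : v ∈ ⨆ i, (D.W i).toSubmodule := htop ▸ Submodule.mem_top
    obtain ⟨t, ht⟩ := Submodule.exists_finset_of_mem_iSup _ hv
    refine ⟨t, ?_⟩
    rw [← LieSubmodule.mem_toSubmodule]
    simpa only [LieSubmodule.iSup_toSubmodule] using ht
  choose t ht using hmem
  -- Each vector of the finite spanning set `s` of `F` lies in a finite partial sum; the union of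
  -- these index sets gives a submodule containing `F`.
  have hU : (⨆ i ∈ s.biUnion t, D.W i) = ⊤ := by
    refine hF _ ?_
    rw [← hs, Submodule.span_le]
    intro v hv
    have hle : (⨆ i ∈ t v, D.W i) ≤ ⨆ i ∈ s.biUnion t, D.W i :=
      biSup_mono fun i hi => Finset.mem_biUnion.mpr ⟨v, hv, hi⟩
    exact hle (ht v)
  have hind : iSupIndep D.W := by
    rw [← LieSubmodule.iSupIndep_toSubmodule]
    exact D.isInternal.submodule_iSupIndep
  have hall : ∀ i, i ∈ s.biUnion t := by
    intro i
    by_contra hi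
    -- A further summand would be independent of a sum that is already everything, hence zero, which
    -- an irreducible module is not.
    have hdisj : Disjoint (D.W i) (⨆ j ∈ s.biUnion t, D.W j) :=
      (hind i).mono_right (biSup_mono fun j hj (e : j = i) => hi (e ▸ hj))
    rw [hU, disjoint_top] at hdisj
    have := D.irreducible i
    have hnt := LieModule.nontrivial_of_isIrreducible ℂ LorentzAlgebra (D.W i)
    exact (LieSubmodule.nontrivial_iff_ne_bot ℂ LorentzAlgebra M).mp hnt hdisj
  exact Finite.of_injective (fun i => (⟨i, hall i⟩ : (s.biUnion t : Finset ι)))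
    fun i j h => by simpa using h

/-- A homomorphism to `V_{λ,ρ}` is a combination of the projections to the components isomorphic to
`V_{λ,ρ}`. -/
theorem exists_hom_eq_sum [Finite ι] (D : ClebschGordanDecomposition M ι) {l : ℤ} {rho : ℂ}
    (φ : D.Frame l rho) (T : M →ₗ⁅ℂ, LorentzAlgebra⁆ LorentzModule l rho) :
    ∃ N : D.Occurrences l rho → ℂ, ∀ v,
      T v = ∑ᶠ α, N α • (φ α).toLinearEquiv.symm (D.component α.1 v) := by
  classical
  have := Fintype.ofFinite ι
  -- Here the constants arise: `T` following `φ α` is an endomorphism of `V_{λ,ρ}`, so it is a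
  -- scalar, with no reference to any basis vector.
  have hscalar : ∀ α : D.Occurrences l rho, ∃ c : ℂ, ∀ u,
      T ((φ α u : D.W α.1) : M) = c • u := fun α =>
    LorentzModule.exists_eq_smul l rho
      ((T.comp (D.W α.1).incl).comp (φ α).toLieModuleHom)
  choose N hN using hscalar
  refine ⟨N, fun v => ?_⟩
  -- The summand is extended by zero from the occurrences to all of `ι`. Only these two properties
  -- are kept, which hides the dependent `if`.
  obtain ⟨term, hocc, hnot⟩ : ∃ term : ι → LorentzModule l rho,
      (∀ α : D.Occurrences l rho,
        term α.1 = N α • (φ α).toLinearEquiv.symm (D.component α.1 v)) ∧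
      ∀ i, ¬ Nonempty (LorentzModule l rho ≃ₗ⁅ℂ, LorentzAlgebra⁆ D.W i) → term i = 0 :=
    ⟨fun i => if h : Nonempty (LorentzModule l rho ≃ₗ⁅ℂ, LorentzAlgebra⁆ D.W i) then
      N ⟨i, h⟩ • (φ ⟨i, h⟩).toLinearEquiv.symm (D.component i v) else 0,
      fun α => dif_pos α.2, fun i h => dif_neg h⟩
  have hterm : ∀ i, T (D.component i v : M) = term i := by
    intro i
    by_cases h : Nonempty (LorentzModule l rho ≃ₗ⁅ℂ, LorentzAlgebra⁆ D.W i)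
    · let α : D.Occurrences l rho := ⟨i, h⟩
      rw [show term i = _ from hocc α, ← hN α]
      exact congrArg (fun w : D.W α.1 => T (w : M))
        ((φ α).toLinearEquiv.apply_symm_apply (D.component α.1 v)).symm
    -- A nonzero value of `T` on `W_i` would make its restriction an isomorphism onto `V_{λ,ρ}`, so
    -- `i` would be an occurrence.
    · rw [hnot i h]
      have := D.irreducible i
      by_contra hne
      refine h ⟨(LieModuleHom.nonempty_equiv_of_ne_zero (T.comp (D.W i).incl)
        fun h0 => ?_).some.symm⟩
      exact hne (LieModuleHom.congr_fun h0 (D.component i v))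
  conv_lhs => rw [← D.sum_component v, map_sum]
  rw [Finset.sum_congr rfl fun i _ => hterm i, ← finsum_eq_sum_of_fintype]
  -- The terms vanish off the occurrences, so the sum over `ι` equals the sum over that subtype.
  have hsupp : Function.support term ⊆
      {i | Nonempty (LorentzModule l rho ≃ₗ⁅ℂ, LorentzAlgebra⁆ D.W i)} := fun i hi => by
    by_contra h
    exact hi (hnot i h)
  rw [← Set.indicator_eq_self.mpr hsupp, ← finsum_mem_def, ← finsum_set_coe_eq_finsum_mem]
  exact finsum_congr hocc

end ClebschGordanDecomposition

end

theorem mainTheorem5 (g₁ g₂ : ℕ) (l : ℤ) (rho : ℂ) (l' : ℤ) (rho' : ℂ)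
    (hV : ¬ FiniteDimensional ℂ (LorentzModule l rho))
    (hV' : ¬ FiniteDimensional ℂ (LorentzModule l' rho'))
    (T : TensorOperator g₁ g₂ l rho l' rho')
    {ι : Type*} [DecidableEq ι]
    (D : ClebschGordanDecomposition (ProductModule g₁ g₂ l rho) ι)
    (φ : D.Frame l' rho') :
    Finite (D.Occurrences l' rho') ∧
    (∃ N : D.Occurrences l' rho' → ℂ,
      ∀ (y : SpinIndex (lorentzSpins l' rho')) (x : ProductIndex g₁ g₂ l rho),
        T.matrixElement y x = ∑ᶠ α, N α * inverseClebschGordan D φ α y x) ∧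
    (IsEmpty (D.Occurrences l' rho') → T = 0) := by
  have hι : Finite ι := by
    obtain ⟨v, hv⟩ := exists_ne (0 : LorentzModule l rho)
    -- The finite-dimensional generating subspace is `(γ₁, γ₂) ⊗ v`.
    refine D.finite_index (LinearMap.range
      ((TensorProduct.mk ℂ (FiniteLorentzModule g₁ g₂) (LorentzModule l rho)).flip v))
      fun U hU => U.eq_top_of_tmul_mem hv fun m => hU ⟨m, rfl⟩
  -- `∑ᶠ` takes the value `0` on an infinite support; finiteness makes it a genuine sum.
  have hfin : Finite (D.Occurrences l' rho') := Subtype.finite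
  obtain ⟨N, hN⟩ := D.exists_hom_eq_sum φ T
  refine ⟨hfin, ⟨N, fun y x => ?_⟩, fun h => LieModuleHom.ext fun v => ?_⟩
  · have := Fintype.ofFinite (D.Occurrences l' rho')
    rw [TensorOperator.matrixElement, hN, finsum_eq_sum_of_fintype, finsum_eq_sum_of_fintype,
      map_sum, Finsupp.finsetSum_apply]
    refine Finset.sum_congr rfl fun α _ => ?_
    -- What remains is definitional: coordinates in the transported basis `frameBasis` are the
    -- standard coordinates after `(φ α)⁻¹`.
    rw [map_smul, Finsupp.smul_apply, smul_eq_mul]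
    rfl
  · rw [hN, finsum_of_isEmpty]
    rfl
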